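/- Let $R$ be a commutative Noetherian ring and $\Lambda$ a (not necessarily commutative) $R$-algebra that is finitely generated as an $R$-module. For a prime ideal $\mathfrak p$ of $R$ put $\Lambda_{\mathfrak p}=R_{\mathfrak p}\otimes_R\Lambda$. Let $\mathsf{D}^{\mathrm b}(\mathrm{mod}\,\Lambda)$ be the bounded derived category of finitely generated left $\Lambda$-modules, viewed inside $\mathsf{D}(\mathrm{Mod}\,\Lambda)$, and let $\mathsf{K}^{\mathrm b}(\mathrm{proj}\,\Lambda)\subseteq\mathsf{D}^{\mathrm b}(\mathrm{mod}\,\Lambda)$ be the full subcategory of objects isomorphic to bounded complexes of finitely generated projective $\Lambda$-modules (perfect complexes); likewise for $\Lambda_{\mathfrak p}$. For $P\in\mathsf{D}^{\mathrm b}(\mathrm{mod}\,\Lambda)$, let $P_{\mathfrak p}\in\mathsf{D}^{\mathrm b}(\mathrm{mod}\,\Lambda_{\mathfrak p})$ be its image under the functor induced by the exact functor $R_{\mathfrak p}\otimes_R(-)$. A silting complex over $\Lambda$ is an object $P$ of $\mathcal T=\mathsf{K}^{\mathrm b}(\mathrm{proj}\,\Lambda)$ such that $\mathrm{Hom}_{\mathcal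 T}(P,P[i])=0$ for all $i>0$ and the smallest triangulated subcategory of $\mathcal T$ that contains $P$ and is closed under direct summands is $\mathcal T$ itself; likewise over $\Lambda_{\mathfrak p}$. Then for every $P\in\mathsf{D}^{\mathrm b}(\mathrm{mod}\,\Lambda)$: (a) $P\in\mathsf{K}^{\mathrm b}(\mathrm{proj}\,\Lambda)$ if and only if $P_{\mathfrak p}\in\mathsf{K}^{\mathrm b}(\mathrm{proj}\,\Lambda_{\mathfrak p})$ for every $\mathfrak p\in\mathrm{Spec}\,R$. (b) $P$ is a silting complex over $\Lambda$ if and only if $P_{\mathfrak p}$ is a silting complex over $\Lambda_{\mathfrak p}$ for every $\mathfrak p\in\mathrm{Spec}\,R$. -/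

import Mathlib

open CategoryTheory
open scoped TensorProduct ZeroObject

universe w w' u

noncomputable section

section LocalizationFunctor

variable {R : Type u} [CommRing R] (Λ : Type u) [Ring Λ] [Algebra R Λ] (S : Submonoid R)

/-- The localisation `Λ_S = R_S ⊗_R Λ` of an `R`-algebra `Λ`. -/
abbrev LocAlg : Type u := Localization S ⊗[R] Λ

variable {Λ}

/-- A `Λ`-module, regarded as an `R`-module. -/
@[reducible] def baseModule (M : ModuleCat.{u} Λ) : Module R M := Module.restrictScalars R Λ M

attribute [local instance] baseModule

lemma baseModule_isScalarTower (M : ModuleCat.{u} Λ) : IsScalarTower R Λ M :=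
  IsScalarTower.restrictScalars R Λ M

attribute [local instance] baseModule_isScalarTower

/-- The action of `R_S ⊗_R Λ` on `R_S ⊗_R M`, given on pure tensors by
`(a ⊗ x) • (b ⊗ m) = (a * b) ⊗ (x • m)`. -/
def locAction (M : ModuleCat.{u} Λ) :
    LocAlg Λ S →ₐ[R] Module.End R (Localization S ⊗[R] M) :=
  (Module.endTensorEndAlgHom (R := R) (S := R) (A := R)).comp
    (Algebra.TensorProduct.map (Algebra.lmul R (Localization S)) (Algebra.lsmul R R M))

lemma locAction_tmul (M : ModuleCat.{u} Λ) (a b : Localization S) (x : Λ) (m : M) :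
    locAction S M (a ⊗ₜ x) (b ⊗ₜ m) = (a * b) ⊗ₜ (x • m) := by
  simp [locAction, Module.endTensorEndAlgHom_apply]

/-- The localisation `M_S = R_S ⊗_R M` of a `Λ`-module `M`, as a `Λ_S`-module. -/
def locModule (M : ModuleCat.{u} Λ) : ModuleCat.{u} (LocAlg Λ S) :=
  letI : Module (LocAlg Λ S) (Localization S ⊗[R] M) :=
    Module.compHom _ (locAction S M).toRingHom
  ModuleCat.of (LocAlg Λ S) (Localization S ⊗[R] M)

lemma lTensor_locAction {M N : ModuleCat.{u} Λ} (f : M ⟶ N) (c : LocAlg Λ S)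
    (y : Localization S ⊗[R] M) :
    LinearMap.lTensor (Localization S) (f.hom.restrictScalars R) (locAction S M c y) =
      locAction S N c (LinearMap.lTensor (Localization S) (f.hom.restrictScalars R) y) := by
  induction c using TensorProduct.induction_on with
  | zero => simp
  | add c d hc hd => simp only [map_add, LinearMap.add_apply, hc, hd]
  | tmul a x =>
    induction y using TensorProduct.induction_on with
    | zero => simp
    | add y z hy hz => simp only [map_add, hy, hz]
    | tmul b m => simp [locAction_tmul]

/-- The localisation functor `(-)_S = R_S ⊗_R (-) : Mod Λ ⥤ Mod Λ_S`. -/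
def locFunctor : ModuleCat.{u} Λ ⥤ ModuleCat.{u} (LocAlg Λ S) where
  obj M := locModule S M
  map {M N} f := ModuleCat.ofHom (X := locModule S M) (Y := locModule S N)
    { toFun := LinearMap.lTensor (Localization S) (f.hom.restrictScalars R)
      map_add' := map_add _
      map_smul' := lTensor_locAction S f }
  map_id M := by
    ext y
    exact LinearMap.congr_fun (LinearMap.lTensor_id (R := R) (N := M) (M := Localization S)) y
  map_comp {M N K} f g := by
    ext y
    exact LinearMap.congr_fun (LinearMap.lTensor_comp (Localization S)
      (g.hom.restrictScalars R) (f.hom.restrictScalars R)) y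

instance : (locFunctor (Λ := Λ) S).Additive where
  map_add {M N f g} := by
    ext y
    exact LinearMap.congr_fun (LinearMap.lTensor_add (Localization S)
      (f.hom.restrictScalars R) (g.hom.restrictScalars R)) y

lemma locFunctor_map_exact (T : ShortComplex (ModuleCat.{u} Λ)) (h : T.Exact) :
    (T.map (locFunctor S)).Exact := by
  rw [ShortComplex.ShortExact.moduleCat_exact_iff_function_exact] at h ⊢
  exact Module.Flat.lTensor_exact (R := R) (Localization S)
    (f := T.f.hom.restrictScalars R) (g := T.g.hom.restrictScalars R) h

instance : Limits.PreservesFiniteLimits (locFunctor (Λ := Λ) S) :=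
  (((Functor.exact_tfae (locFunctor (Λ := Λ) S)).out 1 3 rfl rfl).mp
    (locFunctor_map_exact S)).1

instance : Limits.PreservesFiniteColimits (locFunctor (Λ := Λ) S) :=
  (((Functor.exact_tfae (locFunctor (Λ := Λ) S)).out 1 3 rfl rfl).mp
    (locFunctor_map_exact S)).2

end LocalizationFunctor

section Silting

variable {T : Type*} [Category* T] [Preadditive T] [Limits.HasZeroObject T] [HasShift T ℤ]
  [∀ n : ℤ, (shiftFunctor T n).Additive] [Pretriangulated T]

/-- An object `P` of a triangulated category is presilting if `Hom(P, P[i]) = 0` for all `i > 0`. -/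
def IsPresilting (P : T) : Prop := ∀ i : ℤ, 0 < i → ∀ f : P ⟶ P⟦i⟧, f = 0

/-- An object `P` of a triangulated category `T` is silting if it is presilting and `thick P = T`,
where `thick P` is the smallest triangulated subcategory closed under direct summands that
contains `P`. -/
def IsSilting (P : T) : Prop :=
  IsPresilting P ∧ (ObjectProperty.singleton P).triangEnvelope = ⊤

end Silting

section Derived

variable (Λ : Type u) [Ring Λ]

/-- `K` is a bounded complex all of whose terms are in `A`. -/
def IsBoundedComplexIn {Λ : Type u} [Ring Λ] (A : ObjectProperty (ModuleCat.{u} Λ))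
    (K : CochainComplex (ModuleCat.{u} Λ) ℤ) : Prop :=
  (∀ n, A (K.X n)) ∧ ∃ a b : ℤ, K.IsStrictlyGE a ∧ K.IsStrictlyLE b

/-- The finitely generated projective `Λ`-modules. -/
def fgProj : ObjectProperty (ModuleCat.{u} Λ) :=
  fun M => Module.Finite Λ M ∧ Module.Projective Λ M

lemma isKProjective_of_isBoundedComplexIn {K : CochainComplex (ModuleCat.{u} Λ) ℤ}
    (hK : IsBoundedComplexIn (fgProj Λ) K) : K.IsKProjective := by
  obtain ⟨hK, a, b, _, _⟩ := hK
  have : ∀ n, Projective (K.X n) := fun n =>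
    (IsProjective.iff_projective (K.X n)).1 (hK n).2
  exact CochainComplex.isKProjective_of_projective K b

lemma fgProj_biprod {M N : ModuleCat.{u} Λ} (hM : fgProj Λ M) (hN : fgProj Λ N) :
    fgProj Λ (M ⊞ N) := by
  obtain ⟨_, _⟩ := hM
  obtain ⟨_, _⟩ := hN
  let e : (M × N) ≃ₗ[Λ] (M ⊞ N : ModuleCat.{u} Λ) := (ModuleCat.biprodIsoProd M N).symm.toLinearEquiv
  exact ⟨Module.Finite.equiv e, Module.Projective.of_equiv e⟩

lemma isBoundedComplexIn_mappingCone {K L : CochainComplex (ModuleCat.{u} Λ) ℤ} (f : K ⟶ L)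
    (hK : IsBoundedComplexIn (fgProj Λ) K) (hL : IsBoundedComplexIn (fgProj Λ) L) :
    IsBoundedComplexIn (fgProj Λ) (CochainComplex.mappingCone f) := by
  obtain ⟨hK, a, b, _, _⟩ := hK
  obtain ⟨hL, c, d, _, _⟩ := hL
  have e (n : ℤ) : (CochainComplex.mappingCone f).X n ≅ K.X (n + 1) ⊞ L.X n :=
    HomologicalComplex.homotopyCofiber.XIsoBiprod f n (n + 1) rfl
  refine ⟨fun n => ?_, min (a - 1) c, max (b - 1) d, ?_, ?_⟩
  · obtain ⟨_, _⟩ := fgProj_biprod Λ (hK (n + 1)) (hL n)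
    exact ⟨Module.Finite.equiv (e n).symm.toLinearEquiv,
      Module.Projective.of_equiv (e n).symm.toLinearEquiv⟩
  · rw [CochainComplex.isStrictlyGE_iff]
    intro i hi
    refine Limits.IsZero.of_iso ?_ (e i)
    rw [Limits.biprod_isZero_iff]
    exact ⟨K.isZero_of_isStrictlyGE a _ (by lia), L.isZero_of_isStrictlyGE c _ (by lia)⟩
  · rw [CochainComplex.isStrictlyLE_iff]
    intro i hi
    refine Limits.IsZero.of_iso ?_ (e i)
    rw [Limits.biprod_isZero_iff]
    exact ⟨K.isZero_of_isStrictlyLE b _ (by lia), L.isZero_of_isStrictlyLE d _ (by lia)⟩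

variable [HasDerivedCategory.{w} (ModuleCat.{u} Λ)]

/-- `Dᵇ(mod Λ)` as a full subcategory of `D(Mod Λ)`: the objects isomorphic in `D(Mod Λ)` to a
bounded complex of finitely generated modules. -/
def dbMod : ObjectProperty (DerivedCategory (ModuleCat.{u} Λ)) := fun X =>
  ∃ K : CochainComplex (ModuleCat.{u} Λ) ℤ,
    IsBoundedComplexIn (ModuleCat.isFG Λ) K ∧ Nonempty (X ≅ DerivedCategory.Q.obj K)

/-- `Kᵇ(proj Λ)` as a full subcategory of `D(Mod Λ)` (the perfect complexes): the objects
isomorphic in `D(Mod Λ)` to a bounded complex of finitely generated projective modules. -/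
def kbProj : ObjectProperty (DerivedCategory (ModuleCat.{u} Λ)) := fun X =>
  ∃ K : CochainComplex (ModuleCat.{u} Λ) ℤ,
    IsBoundedComplexIn (fgProj Λ) K ∧ Nonempty (X ≅ DerivedCategory.Q.obj K)

instance : (kbProj Λ).IsClosedUnderIsomorphisms where
  of_iso := by
    rintro X Y e ⟨K, hK, ⟨e'⟩⟩
    exact ⟨K, hK, ⟨e.symm ≪≫ e'⟩⟩

instance : (kbProj Λ).ContainsZero where
  exists_zero := by
    have h0 (n : ℤ) : Limits.IsZero
        ((0 : CochainComplex (ModuleCat.{u} Λ) ℤ).X n) :=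
      (HomologicalComplex.eval _ _ n).map_isZero (Limits.isZero_zero _)
    refine ⟨DerivedCategory.Q.obj 0, DerivedCategory.Q.map_isZero (Limits.isZero_zero _), 0,
      ⟨fun n => ?_, 0, 0, ?_, ?_⟩, ⟨Iso.refl _⟩⟩
    · have := ModuleCat.subsingleton_of_isZero (h0 n)
      exact ⟨Module.Finite.of_finite, Module.Projective.of_free⟩
    · rw [CochainComplex.isStrictlyGE_iff]
      exact fun i _ => h0 i
    · rw [CochainComplex.isStrictlyLE_iff]
      exact fun i _ => h0 i

instance : (kbProj Λ).IsStableUnderShift ℤ where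
  isStableUnderShiftBy n :=
    { le_shift := by
        rintro X ⟨K, ⟨hK, a, b, ha, hb⟩, ⟨e⟩⟩
        refine ⟨K⟦n⟧, ⟨fun i => hK (i + n), a - n, b - n,
          K.isStrictlyGE_shift a n (a - n) (by lia),
          K.isStrictlyLE_shift b n (b - n) (by lia)⟩, ⟨?_⟩⟩
        exact (shiftFunctor _ n).mapIso e ≪≫ (DerivedCategory.Q.commShiftIso n).symm.app K }

open Pretriangulated in
instance : (kbProj Λ).IsTriangulatedClosed₃ := .mk' (by
  rintro T hT ⟨K, hK, ⟨eK⟩⟩ ⟨L, hL, ⟨eL⟩⟩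
  have := isKProjective_of_isBoundedComplexIn Λ hK
  obtain ⟨g, hg⟩ := (CochainComplex.IsKProjective.Qh_map_bijective K
    ((HomotopyCategory.quotient _ _).obj L)).surjective
      ((DerivedCategory.quotientCompQhIso _).hom.app K ≫ eK.inv ≫ T.mor₁ ≫ eL.hom ≫
        (DerivedCategory.quotientCompQhIso _).inv.app L)
  obtain ⟨f, rfl⟩ := (HomotopyCategory.quotient _ _).map_surjective g
  have hf : T.mor₁ ≫ eL.hom = eK.hom ≫ DerivedCategory.Q.map f := by
    have h := DerivedCategory.quotientCompQhIso_hom_naturality f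
    rw [hg] at h
    simp only [Category.assoc, Iso.inv_hom_id_app, Category.comp_id] at h
    rw [← Iso.inv_comp_eq]
    exact (cancel_epi _).1 h
  exact ⟨_, isBoundedComplexIn_mappingCone Λ f hK hL,
    ⟨Triangle.π₃.mapIso (isoTriangleOfIso₁₂ _ _ hT
      (DerivedCategory.mappingCone_triangle_distinguished f) eK eL hf)⟩⟩)

instance : (kbProj Λ).IsTriangulated where
  toIsTriangulatedClosed₂ := .of_isTriangulatedClosed₃

/-- A silting complex of `Λ`: a silting object of the triangulated category `Kᵇ(proj Λ)`. -/
def IsSiltingComplex (X : DerivedCategory (ModuleCat.{u} Λ)) : Prop :=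
  ∃ hX : kbProj Λ X, IsSilting (⟨X, hX⟩ : (kbProj Λ).FullSubcategory)

end Derived

section Localization

variable {R : Type u} [CommRing R] {Λ : Type u} [Ring Λ] [Algebra R Λ]
  [HasDerivedCategory.{w} (ModuleCat.{u} Λ)]

/-- The localisation `P_𝔭` of an object `P` of `D(Mod Λ)` at a prime `𝔭` of `R`, an object of
`D(Mod Λ_𝔭)`: the exact functor `R_𝔭 ⊗_R (-)` applied to complexes. -/
def locAtPrime (p : PrimeSpectrum R)
    [HasDerivedCategory.{w'} (ModuleCat.{u} (LocAlg Λ p.asIdeal.primeCompl))]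
    (P : DerivedCategory (ModuleCat.{u} Λ)) :
    DerivedCategory (ModuleCat.{u} (LocAlg Λ p.asIdeal.primeCompl)) :=
  (locFunctor p.asIdeal.primeCompl).mapDerivedCategory.obj P

end Localization

end

set_option linter.unusedSectionVars false

/-! ### Morphisms out of shifted projectives and K-projective complexes -/

namespace CochainComplex

variable {C : Type*} [Category* C] [Abelian C]

/-! Perfectness and generation are both detected by a sequence of morphisms `f n` out of a fixed
object, each a composite of the previous one with a further map, such that the property holds as
soon as one `f n` is zero. The local hypothesis at 𝔭 makes some `f n` vanish after localisation, and
Hom localises well enough to give s ∉ 𝔭 with s • f n = 0. The annihilators of the `f n` form an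
ascending chain in the noetherian ring R. Its stable value lies in no maximal ideal, hence is R, and
that `f n` is zero (`exists_eq_zero_of_locally`).

For (a), coning off finite free covers of the top homology gives P ⟶ Y n with Y n in D^{≤ b-n},
through which every map from P to D^{≤ b-n} factors (`exists_isLEApprox`). A bounded object with
finitely generated homology is perfect exactly when it has no nonzero maps into D^{≤ c} for some c
(`kbProj_of_hom_eq_zero`, `exists_hom_eq_zero_of_kbProj`), so the vanishing of one of these maps
suffices.

For (b), morphisms out of a perfect complex localise (`homLocalized_of_kbProj`), which settles the
presilting condition. Generation means that Λ lies in thick P. `exists_ghost_tower` builds a tower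
under Λ whose steps kill all maps from shifts of P and whose composites have cones in thick P. Since
Λ_𝔭 lies in thick P_𝔭, the ghost lemma (`eventuallyGhost_of_triangEnvelope`) makes the localised
composites eventually zero. Once a composite out of Λ is zero, Λ⟦1⟧ is a retract of its cone. -/

lemma exists_homologyMap_eq_of_single (K : CochainComplex C ℤ) {n : ℤ} {M : C} [Projective M]
    (φ : M ⟶ K.homology n) :
    ∃ f : (HomologicalComplex.single C (.up ℤ) n).obj M ⟶ K,
      HomologicalComplex.homologyMap f n =
        (HomologicalComplex.singleObjHomologySelfIso (.up ℤ) n M).hom ≫ φ := by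
  obtain ⟨ψ, hψ⟩ : ∃ ψ : M ⟶ K.cycles n, ψ ≫ K.homologyπ n = φ :=
    Projective.factors φ (K.homologyπ n)
  let g : (HomologicalComplex.single C (.up ℤ) n).obj M ⟶ K :=
    HomologicalComplex.mkHomFromSingle (ψ ≫ K.iCycles n) (fun i hi => by simp)
  have hg : (HomologicalComplex.singleObjCyclesSelfIso (.up ℤ) n M).inv ≫
      HomologicalComplex.cyclesMap g n = ψ := by
    rw [← cancel_mono (K.iCycles n), Category.assoc, HomologicalComplex.cyclesMap_i,
      HomologicalComplex.singleObjCyclesSelfIso_inv_iCycles_assoc]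
    simp [g]
  refine ⟨g, ?_⟩
  rw [← hψ, ← hg, ← cancel_epi (HomologicalComplex.singleObjHomologySelfIso (.up ℤ) n M).inv,
    ← HomologicalComplex.singleObjCyclesSelfIso_inv_homologyπ, Category.assoc,
    HomologicalComplex.homologyπ_naturality]
  simp only [HomologicalComplex.singleObjCyclesSelfIso_inv_homologyπ_assoc, Iso.inv_hom_id_assoc,
    Category.assoc]

end CochainComplex

namespace DerivedCategory

open Limits Pretriangulated

variable {C : Type*} [Category* C] [Abelian C] [HasDerivedCategory.{w} C]

lemma Q_map_surjective_of_isKProjective (K L : CochainComplex C ℤ) [K.IsKProjective] :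
    Function.Surjective (Q.map : (K ⟶ L) → (Q.obj K ⟶ Q.obj L)) := by
  intro f
  obtain ⟨g, hg⟩ := (CochainComplex.IsKProjective.Qh_map_bijective K
    ((HomotopyCategory.quotient _ _).obj L)).surjective
      ((quotientCompQhIso _).hom.app K ≫ f ≫ (quotientCompQhIso _).inv.app L)
  obtain ⟨g, rfl⟩ := (HomotopyCategory.quotient _ _).map_surjective g
  refine ⟨g, ?_⟩
  have h := quotientCompQhIso_hom_naturality g
  rw [hg] at h
  simp only [Category.assoc, Iso.inv_hom_id_app, Category.comp_id] at h
  exact ((cancel_epi _).1 h).symm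

/-- The homology in degree `n` of a single complex in degree `n`. -/
noncomputable def homologySingleIso (n : ℤ) (M : C) :
    (homologyFunctor C n).obj ((singleFunctor C n).obj M) ≅ M :=
  (singleFunctorCompHomologyFunctorIso C n).app M

instance (n : ℤ) (M : C) [Projective M] :
    Projective ((homologyFunctor C n).obj ((singleFunctor C n).obj M)) :=
  Projective.of_iso (homologySingleIso n M).symm inferInstance

lemma exists_hom_from_single {M : C} [Projective M] {n : ℤ} {X : DerivedCategory C}
    (φ : (homologyFunctor C n).obj ((singleFunctor C n).obj M) ⟶ (homologyFunctor C n).obj X) :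
    ∃ f : (singleFunctor C n).obj M ⟶ X, (homologyFunctor C n).map f = φ := by
  obtain ⟨L, ⟨e⟩⟩ : ∃ L, Nonempty (Q.obj L ≅ X) := ⟨_, ⟨Q.objObjPreimageIso X⟩⟩
  let q : (singleFunctor C n).obj M ≅ Q.obj ((HomologicalComplex.single C (.up ℤ) n).obj M) :=
    Iso.refl _
  let a (K : CochainComplex C ℤ) : (homologyFunctor C n).obj (Q.obj K) ≅ K.homology n :=
    (homologyFunctorFactors C n).app K
  have ha {K L : CochainComplex C ℤ} (f : K ⟶ L) :
    (homologyFunctor C n).map (Q.map f) ≫ (a L).hom =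
      (a K).hom ≫ HomologicalComplex.homologyMap f n := homologyFunctorFactors_hom_naturality f n
  obtain ⟨g, hg⟩ := CochainComplex.exists_homologyMap_eq_of_single (M := M) L
    ((HomologicalComplex.singleObjHomologySelfIso (.up ℤ) n M).inv ≫ (a _).inv ≫
      (homologyFunctor C n).map q.inv ≫ φ ≫ (homologyFunctor C n).map e.inv ≫ (a L).hom)
  refine ⟨q.hom ≫ Q.map g ≫ e.hom, ?_⟩
  have h := ha g
  rw [hg, Iso.hom_inv_id_assoc, Iso.hom_inv_id_assoc] at h
  simp only [← Category.assoc] at h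
  rw [cancel_mono] at h
  rw [Functor.map_comp, Functor.map_comp, h]
  simp only [← Functor.map_comp, ← Functor.map_comp_assoc, Category.assoc, e.inv_hom_id,
    q.hom_inv_id]
  simp only [CategoryTheory.Functor.map_id, Category.comp_id, Category.id_comp]

/-- This is the injective half of Hom(M[-n], X) ≅ Hom(M, Hⁿ X); `exists_hom_from_single` is the
surjective half. As f is zero on Hⁿ, the connecting map δ from the cone is epi and splits because M
is projective. Realising the splitting by k makes `k ≫ h` an isomorphism, and `h ≫ f⟦1⟧' = 0` then
forces f = 0. -/
lemma hom_from_single_eq_zero {M : C} [Projective M] {n : ℤ} {X : DerivedCategory C}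
    (f : (singleFunctor C n).obj M ⟶ X) (hf : (homologyFunctor C n).map f = 0) : f = 0 := by
  obtain ⟨Z, g, h, hT⟩ := distinguished_cocone_triangle f
  have ex := HomologySequence.exact₁ _ hT (n - 1) n
  let δ : (homologyFunctor C (n - 1)).obj Z ⟶
    (homologyFunctor C n).obj ((singleFunctor C n).obj M) :=
      HomologySequence.δ (Triangle.mk f g h) (n - 1) n
  have hδ : Epi δ := ex.epi_f hf
  obtain ⟨ψ, hψ⟩ : ∃ ψ : (homologyFunctor C n).obj ((singleFunctor C n).obj M) ⟶
      (homologyFunctor C (n - 1)).obj Z, ψ ≫ δ = 𝟙 _ := Projective.factors (𝟙 _) δ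
  obtain ⟨k, hk⟩ := exists_hom_from_single
    ((homologySingleIso (n - 1) M).hom ≫ (homologySingleIso n M).inv ≫ ψ)
  let s : (homologyFunctor C (n - 1)).obj (((singleFunctor C n).obj M)⟦(1 : ℤ)⟧) ≅
      (homologyFunctor C n).obj ((singleFunctor C n).obj M) :=
    ((homologyFunctor C 0).shiftIso 1 (n - 1) n (by lia)).app _
  have hs : (homologyFunctor C (n - 1)).map h ≫ s.hom = δ := rfl
  have h1 : (homologyFunctor C (n - 1)).map (k ≫ h) =
      (homologySingleIso (n - 1) M).hom ≫ (homologySingleIso n M).inv ≫ s.inv := by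
    rw [← cancel_mono s.hom, Functor.map_comp, Category.assoc, hs, hk]
    simp [hψ]
  have h3 : IsIso (k ≫ h) := by
    rw [isIso_iff]
    intro i
    by_cases hi : i = n - 1
    · subst hi; rw [h1]; infer_instance
    · have : ((((singleFunctor C n).obj M)⟦(1 : ℤ)⟧).IsLE (n - 1)) :=
        TStructure.t.isLE_shift _ n 1 (n - 1)
      have : ((((singleFunctor C n).obj M)⟦(1 : ℤ)⟧).IsGE (n - 1)) :=
        TStructure.t.isGE_shift _ n 1 (n - 1)
      rcases lt_or_gt_of_ne hi with hi | hi
      · exact ⟨0, (isZero_of_isGE _ (n - 1) i hi).eq_of_src _ _,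
          (isZero_of_isGE _ (n - 1) i hi).eq_of_src _ _⟩
      · exact ⟨0, (isZero_of_isLE _ (n - 1) i hi).eq_of_src _ _,
          (isZero_of_isLE _ (n - 1) i hi).eq_of_src _ _⟩
  have h4 : (k ≫ h) ≫ f⟦(1 : ℤ)⟧' = 0 := by
    have : h ≫ f⟦(1 : ℤ)⟧' = 0 := comp_distTriang_mor_zero₃₁ _ hT
    rw [Category.assoc, this, comp_zero]
  apply (shiftFunctor (DerivedCategory C) (1 : ℤ)).map_injective
  rw [Functor.map_zero, ← cancel_epi (k ≫ h), h4, comp_zero]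

lemma hom_eq_zero_of_isKProjective {K : CochainComplex C ℤ} [K.IsKProjective] {a b : ℤ}
    (hab : b < a) [K.IsStrictlyGE a] {Y : DerivedCategory C} [Y.IsLE b] (f : Q.obj K ⟶ Y) :
    f = 0 := by
  obtain ⟨L, _, ⟨e⟩⟩ := Y.exists_iso_Q_obj_of_isLE b
  obtain ⟨g, hg⟩ := Q_map_surjective_of_isKProjective K L (f ≫ e.hom)
  -- Source and target complexes live in disjoint ranges of degrees.
  have : g = 0 := by
    ext i
    by_cases hi : i < a
    · exact (K.isZero_of_isStrictlyGE a i hi).eq_of_src _ _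
    · exact (L.isZero_of_isStrictlyLE b i (by lia)).eq_of_tgt _ _
  rw [← cancel_mono e.hom, ← hg, this, Functor.map_zero, zero_comp]

end DerivedCategory

/-! ### Triangulated subcategories and factorisations through triangles -/

namespace CategoryTheory.ObjectProperty

open Limits Pretriangulated

variable {T : Type*} [Category* T] [Preadditive T] [HasZeroObject T] [HasShift T ℤ]
  [∀ n : ℤ, (shiftFunctor T n).Additive] [Pretriangulated T]

lemma prop_biproduct [IsTriangulated T] (P : ObjectProperty T) [P.IsTriangulated]
    [P.IsClosedUnderIsomorphisms] {J : Type} [Finite J] [HasFiniteBiproducts T] (f : J → T)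
    (h : ∀ j, P (f j)) : P (⨁ f) :=
  P.prop_of_iso (biproduct.isoProduct f).symm (P.prop_product h)

/-- When f = 0 the identity of X⟦1⟧ factors through the cone of f, so X⟦1⟧ is a retract of it. -/
lemma prop_of_trW_of_eq_zero (P : ObjectProperty T) [P.IsTriangulated] [P.IsStableUnderRetracts]
    {X Y : T} {f : X ⟶ Y} (hf : P.trW f) (h0 : f = 0) : P X := by
  obtain ⟨Z, g, h, hT, hZ⟩ := hf
  obtain ⟨s, hs⟩ := Triangle.coyoneda_exact₁ _ hT (𝟙 (X⟦(1 : ℤ)⟧))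
    (by subst h0; exact (Category.id_comp _).trans ((shiftFunctor T (1 : ℤ)).map_zero _ _))
  have : P (X⟦(1 : ℤ)⟧) := P.prop_of_retract ⟨s, h, hs.symm⟩ hZ
  exact (P.prop_shift_iff_of_isStableUnderShift X (1 : ℤ)).1 this

lemma prop_of_trW_of_prop (P : ObjectProperty T) [P.IsTriangulated] [P.IsClosedUnderIsomorphisms]
    {X Y : T} {f : X ⟶ Y} (hf : P.trW f) (hY : P Y) : P X := by
  obtain ⟨Z, g, h, hT, hZ⟩ := hf
  exact P.ext_of_isTriangulatedClosed₁ _ hT hY hZ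

end CategoryTheory.ObjectProperty

namespace CategoryTheory.Pretriangulated

open Limits

variable {T : Type*} [Category* T] [Preadditive T] [HasZeroObject T] [HasShift T ℤ]
  [∀ n : ℤ, (shiftFunctor T n).Additive] [Pretriangulated T]
  {X Y Z W : T} {f : X ⟶ Y} {g : Y ⟶ Z} {h : Z ⟶ X⟦(1 : ℤ)⟧}

lemma exists_eq_comp_mor₂ (hT : Triangle.mk f g h ∈ distTriang T) (t : Y ⟶ W)
    (ht : f ≫ t = 0) : ∃ t' : Z ⟶ W, t = g ≫ t' :=
  Triangle.yoneda_exact₂ _ hT t ht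

lemma exists_eq_comp_mor₃ (hT : Triangle.mk f g h ∈ distTriang T) (t : Z ⟶ W)
    (ht : g ≫ t = 0) : ∃ t' : X⟦(1 : ℤ)⟧ ⟶ W, t = h ≫ t' :=
  Triangle.yoneda_exact₃ _ hT t ht

lemma exists_eq_comp_mor₁ (hT : Triangle.mk f g h ∈ distTriang T) (t : X ⟶ W)
    (ht : h ≫ t⟦(1 : ℤ)⟧' = 0) : ∃ t' : Y ⟶ W, t = f ≫ t' := by
  obtain ⟨t', ht'⟩ : ∃ t' : Y⟦(1 : ℤ)⟧ ⟶ W⟦(1 : ℤ)⟧, t⟦(1 : ℤ)⟧' = (-(f⟦(1 : ℤ)⟧')) ≫ t' :=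
    Triangle.yoneda_exact₂ _ (rot_of_distTriang _ (rot_of_distTriang _ hT)) (t⟦(1 : ℤ)⟧') ht
  obtain ⟨t', rfl⟩ := (shiftFunctor T (1 : ℤ)).map_surjective t'
  refine ⟨-t', (shiftFunctor T (1 : ℤ)).map_injective ?_⟩
  rw [ht', Functor.map_comp, Functor.map_neg, Preadditive.neg_comp, Preadditive.comp_neg]

lemma exists_eq_mor₂_comp (hT : Triangle.mk f g h ∈ distTriang T) (t : W ⟶ Z)
    (ht : t ≫ h = 0) : ∃ t' : W ⟶ Y, t = t' ≫ g :=
  Triangle.coyoneda_exact₃ _ hT t ht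

end CategoryTheory.Pretriangulated

/-! ### Bounded objects with finitely generated homology -/

namespace ModuleCat

variable {A : Type u} [Ring A]

lemma finite_of_exact [IsNoetherianRing A] (S : ShortComplex (ModuleCat.{u} A)) (hS : S.Exact)
    (h₁ : Module.Finite A S.X₁) (h₃ : Module.Finite A S.X₃) : Module.Finite A S.X₂ := by
  have : IsNoetherian A S.X₂ := isNoetherian_of_range_eq_ker S.f.hom S.g.hom
    ((ShortComplex.moduleCat_exact_iff_range_eq_ker S).1 hS)
  infer_instance

lemma finite_of_iso {M N : ModuleCat.{u} A} (e : M ≅ N) (h : Module.Finite A M) :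
    Module.Finite A N :=
  Module.Finite.equiv e.toLinearEquiv

lemma finite_of_isZero {M : ModuleCat.{u} A} (h : Limits.IsZero M) : Module.Finite A M :=
  have := subsingleton_of_isZero h
  Module.Finite.of_finite

lemma finite_of_epi {M N : ModuleCat.{u} A} (f : M ⟶ N) [Epi f] (h : Module.Finite A M) :
    Module.Finite A N :=
  Module.Finite.of_surjective f.hom ((epi_iff_surjective _).1 inferInstance)

end ModuleCat

namespace DerivedCategory

open Limits Pretriangulated

variable (A : Type u) [Ring A] [HasDerivedCategory.{w} (ModuleCat.{u} A)]

/-- The objects of the derived category all of whose homology modules are finitely generated. -/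
def fgHomology : ObjectProperty (DerivedCategory (ModuleCat.{u} A)) := fun X =>
  ∀ n, Module.Finite A ((homologyFunctor (ModuleCat.{u} A) n).obj X)

instance [IsNoetherianRing A] : (fgHomology A).IsStableUnderRetracts where
  of_retract r hY n :=
    have := ((r.map (homologyFunctor (ModuleCat.{u} A) n)).splitEpi).epi
    ModuleCat.finite_of_epi (r.map (homologyFunctor (ModuleCat.{u} A) n)).r (hY n)

instance [IsNoetherianRing A] : (fgHomology A).IsTriangulated where
  exists_zero := ⟨0, isZero_zero _, fun n =>
    ModuleCat.finite_of_isZero ((homologyFunctor _ n).map_isZero (isZero_zero _))⟩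
  isStableUnderShiftBy n :=
    { le_shift := fun X hX m => ModuleCat.finite_of_iso
        (((homologyFunctor (ModuleCat.{u} A) 0).shiftIso n m (n + m) rfl).app X).symm (hX (n + m)) }
  ext₂' T hT h₁ h₃ := (fgHomology A).le_isoClosure _ fun n =>
    ModuleCat.finite_of_exact _ (HomologySequence.exact₂ T hT n) (h₁ n) (h₃ n)

/-- The bounded objects of the derived category with finitely generated homology modules. -/
def boundedFG : ObjectProperty (DerivedCategory (ModuleCat.{u} A)) :=
  TStructure.t.bounded ⊓ fgHomology A

instance [IsNoetherianRing A] : (boundedFG A).IsTriangulated := by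
  dsimp [boundedFG]; infer_instance

instance [IsNoetherianRing A] : (boundedFG A).IsClosedUnderIsomorphisms := by
  dsimp [boundedFG]; infer_instance

variable {A}

lemma isLE_of_retract {C : Type*} [Category* C] [Abelian C] [HasDerivedCategory.{w} C]
    {X Y : DerivedCategory C} (r : Retract X Y) (n : ℤ) [Y.IsLE n] : X.IsLE n := by
  rw [isLE_iff]
  exact fun i hi => (isZero_of_isLE Y n i hi).of_mono ((r.map (homologyFunctor C i)).i)

lemma isGE_of_retract {C : Type*} [Category* C] [Abelian C] [HasDerivedCategory.{w} C]
    {X Y : DerivedCategory C} (r : Retract X Y) (n : ℤ) [Y.IsGE n] : X.IsGE n := by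
  rw [isGE_iff]
  exact fun i hi => (isZero_of_isGE Y n i hi).of_mono ((r.map (homologyFunctor C i)).i)

instance [IsNoetherianRing A] : (boundedFG A).IsStableUnderRetracts where
  of_retract := by
    rintro X Y r ⟨⟨⟨a, ha⟩, ⟨b, hb⟩⟩, hY⟩
    exact ⟨⟨⟨a, isGE_of_retract r a⟩, ⟨b, isLE_of_retract r b⟩⟩,
      (fgHomology A).prop_of_retract r hY⟩

lemma boundedFG_of_dbMod [IsNoetherianRing A] {X : DerivedCategory (ModuleCat.{u} A)}
    (hX : dbMod A X) : boundedFG A X := by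
  obtain ⟨K, ⟨hK, a, b, _, _⟩, ⟨e⟩⟩ := hX
  refine (boundedFG A).prop_of_iso e.symm ⟨⟨⟨a, inferInstance⟩, ⟨b, inferInstance⟩⟩, fun n => ?_⟩
  have : Module.Finite A (K.X n) := hK n
  have : IsNoetherian A (K.X n) := isNoetherian_of_isNoetherianRing_of_finite A _
  have : Module.Finite A (K.cycles n) :=
    Module.Finite.of_injective (K.iCycles n).hom ((ModuleCat.mono_iff_injective _).1 inferInstance)
  have : Module.Finite A (K.homology n) := ModuleCat.finite_of_epi (K.homologyπ n) this
  exact ModuleCat.finite_of_iso ((homologyFunctorFactors (ModuleCat.{u} A) n).symm.app K) this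

lemma dbMod_of_kbProj {X : DerivedCategory (ModuleCat.{u} A)} (hX : kbProj A X) : dbMod A X := by
  obtain ⟨K, ⟨hK, h⟩, e⟩ := hX
  exact ⟨K, ⟨fun n => (hK n).1, h⟩, e⟩

lemma kbProj_single {M : ModuleCat.{u} A} (hM : fgProj A M) (n : ℤ) :
    kbProj A ((singleFunctor _ n).obj M) := by
  refine ⟨(HomologicalComplex.single _ _ n).obj M, ⟨fun m => ?_, n, n, inferInstance,
    inferInstance⟩, ⟨Iso.refl _⟩⟩
  by_cases h : m = n
  · subst h
    obtain ⟨_, _⟩ := hM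
    let e := (HomologicalComplex.singleObjXSelf (.up ℤ) m M).symm.toLinearEquiv
    exact ⟨Module.Finite.equiv e, Module.Projective.of_equiv e⟩
  · have h0 := HomologicalComplex.isZero_single_obj_X (.up ℤ) n M m h
    have := ModuleCat.subsingleton_of_isZero h0
    exact ⟨Module.Finite.of_finite, Module.Projective.of_free⟩

variable (A) in
/-- The regular module `A`, as an object of the derived category concentrated in degree `0`. -/
noncomputable abbrev regular : DerivedCategory (ModuleCat.{u} A) :=
  (singleFunctor _ 0).obj (ModuleCat.of A A)

variable (A) in
/-- The thick subcategory of the derived category generated by the regular module. -/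
abbrev thickRegular : ObjectProperty (DerivedCategory (ModuleCat.{u} A)) :=
  (ObjectProperty.singleton (regular A)).triangEnvelope

lemma thickRegular_single_biproduct (k : ℕ) (n : ℤ) :
    thickRegular A ((singleFunctor _ n).obj (⨁ fun _ : Fin k => ModuleCat.of A A)) := by
  refine (thickRegular A).prop_of_iso ((singleFunctor _ n).mapBiproduct _).symm
    (ObjectProperty.prop_biproduct _ _ fun _ => ?_)
  refine (thickRegular A).prop_of_iso
    (((singleFunctors (ModuleCat.{u} A)).shiftIso (-n) n 0 (by lia)).app (ModuleCat.of A A)) ?_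
  exact (thickRegular A).le_shift (-n) _ (ObjectProperty.le_triangEnvelope _ _ (by simp))

end DerivedCategory

section

open Limits

variable {A : Type u} [Ring A]

lemma exists_fgProj_epi (N : ModuleCat.{u} A) (hN : Module.Finite A N) :
    ∃ (k : ℕ) (φ : (⨁ fun _ : Fin k => ModuleCat.of A A) ⟶ N), Epi φ := by
  obtain ⟨k, f, hf⟩ := Module.Finite.exists_fin' A N
  have : Epi (ModuleCat.ofHom f) := (ModuleCat.epi_iff_surjective _).2 hf
  exact ⟨k, (ModuleCat.biproductIsoPi fun _ : Fin k => ModuleCat.of A A).hom ≫ ModuleCat.ofHom f,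
    epi_comp _ _⟩

lemma fgProj_biproduct (k : ℕ) : fgProj A (⨁ fun _ : Fin k => ModuleCat.of A A) := by
  let e : (Fin k → A) ≃ₗ[A] (⨁ fun _ : Fin k => ModuleCat.of A A : ModuleCat.{u} A) :=
    (ModuleCat.biproductIsoPi fun _ : Fin k => ModuleCat.of A A).symm.toLinearEquiv
  exact ⟨Module.Finite.equiv e, Module.Projective.of_equiv e⟩

end

/-! ### Approximations into D^{≤ c} and a Hom criterion for perfectness -/

namespace DerivedCategory

open Limits Pretriangulated

section

variable {C : Type*} [Category* C] [Abelian C] [HasDerivedCategory.{w} C]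

lemma hom_from_single_eq_zero_of_isLE {M : C} [Projective M] {n m : ℤ} (h : m < n)
    {X : DerivedCategory C} (hX : X.IsLE m) (f : (singleFunctor C n).obj M ⟶ X) : f = 0 :=
  hom_from_single_eq_zero f ((isZero_of_isLE X m n h).eq_of_tgt _ _)

/-- A morphism `f : X ⟶ Y` of the derived category such that every morphism from `X` to an object
of `D^{≤ c}` factors through `f`, and `f` is right cancellable with respect to the shifts by `1`
of such objects. -/
structure IsLEApprox (c : ℤ) {X Y : DerivedCategory C} (f : X ⟶ Y) : Prop where
  exists_factor : ∀ (Z : DerivedCategory C), Z.IsLE c → ∀ g : X ⟶ Z, ∃ g' : Y ⟶ Z, f ≫ g' = g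
  eq_zero : ∀ (Z : DerivedCategory C), Z.IsLE c → ∀ k : Y ⟶ Z⟦(1 : ℤ)⟧, f ≫ k = 0 → k = 0

lemma isLEApprox_id (c : ℤ) (X : DerivedCategory C) : IsLEApprox c (𝟙 X) where
  exists_factor _ _ g := ⟨g, Category.id_comp g⟩
  eq_zero _ _ k hk := by rwa [Category.id_comp] at hk

lemma IsLEApprox.comp {c d : ℤ} (h : d ≤ c) {X Y Z : DerivedCategory C} {f : X ⟶ Y} {g : Y ⟶ Z}
    (hf : IsLEApprox c f) (hg : IsLEApprox d g) : IsLEApprox d (f ≫ g) where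
  exists_factor W hW k := by
    obtain ⟨k', hk'⟩ := hf.exists_factor W (TStructure.t.isLE_of_le W d c) k
    obtain ⟨k'', hk''⟩ := hg.exists_factor W hW k'
    exact ⟨k'', by rw [Category.assoc, hk'', hk']⟩
  eq_zero W hW k hk := by
    rw [Category.assoc] at hk
    exact hg.eq_zero W hW k (hf.eq_zero W (TStructure.t.isLE_of_le W d c) _ hk)

/-- Both properties come from Hom(M[-n], Z) = 0 for Z in D^{≤ c}, read off the long exact sequence
of Hom(-, Z) and of its shift. -/
lemma isLEApprox_of_distTriang {M : C} [Projective M] {c n : ℤ} (h : c < n)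
    {X Y : DerivedCategory C} {f : (singleFunctor C n).obj M ⟶ X} {g : X ⟶ Y}
    {k : Y ⟶ ((singleFunctor C n).obj M)⟦(1 : ℤ)⟧}
    (hT : Triangle.mk f g k ∈ distTriang (DerivedCategory C)) : IsLEApprox c g where
  exists_factor Z hZ t := by
    obtain ⟨t', ht'⟩ := exists_eq_comp_mor₂ hT t (hom_from_single_eq_zero_of_isLE h hZ _)
    exact ⟨t', ht'.symm⟩
  eq_zero Z hZ t ht := by
    obtain ⟨t', rfl⟩ := exists_eq_comp_mor₃ hT t ht
    obtain ⟨t', rfl⟩ := (shiftFunctor (DerivedCategory C) (1 : ℤ)).map_surjective t'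
    rw [hom_from_single_eq_zero_of_isLE h hZ t', Functor.map_zero, comp_zero]

end

variable {A : Type u} [Ring A] [HasDerivedCategory.{w} (ModuleCat.{u} A)]

variable [IsNoetherianRing A]

/-- A finite free cover of the top homology Hᵇ X lifts to a morphism from the free module placed in
degree b. Its cone loses Hᵇ and gains homology at most in degree b - 1, which is why lower bounds a
≤ b - 1 survive. -/
lemma exists_isLEApprox_succ {X : DerivedCategory (ModuleCat.{u} A)} (hX : boundedFG A X) (b : ℤ)
    [X.IsLE b] : ∃ (Y : DerivedCategory (ModuleCat.{u} A)) (f : X ⟶ Y), Y.IsLE (b - 1) ∧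
      boundedFG A Y ∧ (∀ a : ℤ, a ≤ b - 1 → X.IsGE a → Y.IsGE a) ∧ IsLEApprox (b - 1) f ∧
      (kbProj A ⊓ thickRegular A).trW f := by
  obtain ⟨k, φ, hφ⟩ := exists_fgProj_epi _ (hX.2 b)
  have hM := fgProj_biproduct (A := A) k
  have hPM : (kbProj A ⊓ thickRegular A)
      ((singleFunctor _ b).obj (⨁ fun _ : Fin k => ModuleCat.of A A)) :=
    ⟨kbProj_single hM b, thickRegular_single_biproduct k b⟩
  have : Projective (⨁ fun _ : Fin k => ModuleCat.of A A) :=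
    (IsProjective.iff_projective _).1 hM.2
  generalize (⨁ fun _ : Fin k => ModuleCat.of A A) = M at *
  obtain ⟨f, hf⟩ := exists_hom_from_single ((homologySingleIso b M).hom ≫ φ)
  have hf' : Epi ((homologyFunctor _ b).map f) := by rw [hf]; infer_instance
  obtain ⟨Y, g, h, hT⟩ := distinguished_cocone_triangle f
  have hY : boundedFG A Y := ObjectProperty.ext_of_isTriangulatedClosed₃ _ _ hT
    (boundedFG_of_dbMod (dbMod_of_kbProj hPM.1)) hX
  refine ⟨Y, g, ?_, hY, fun a ha hXa => ?_, isLEApprox_of_distTriang (by lia) hT,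
    ObjectProperty.trW.mk' _ hT hPM⟩
  · rw [isLE_iff]
    intro i hi
    have h3 := isZero_of_isLE ((singleFunctor _ b).obj M) b (i + 1) (by lia)
    have e3 : Epi ((homologyFunctor _ i).map g) :=
      (HomologySequence.exact₃ _ hT i (i + 1)).epi_f (h3.eq_of_tgt _ _)
    have h0 : (homologyFunctor _ i).map g = 0 := by
      rcases eq_or_lt_of_le (show b ≤ i by lia) with rfl | hi
      · exact (HomologySequence.epi_homologyMap_mor₁_iff _ hT b).1 hf'
      · exact (isZero_of_isLE X b i hi).eq_of_src _ _
    rw [IsZero.iff_id_eq_zero, ← cancel_epi ((homologyFunctor _ i).map g), h0, zero_comp, zero_comp]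
  · have := TStructure.t.isGE_shift ((singleFunctor _ b).obj M) b 1 (b - 1)
    exact TStructure.t.isGE₂ _ (rot_of_distTriang _ hT) a hXa
      (TStructure.t.isGE_of_ge (((singleFunctor _ b).obj M)⟦(1 : ℤ)⟧) a (b - 1))

lemma exists_isLEApprox {X : DerivedCategory (ModuleCat.{u} A)} (hX : boundedFG A X) (b : ℤ)
    [X.IsLE b] (n : ℕ) : ∃ (Y : DerivedCategory (ModuleCat.{u} A)) (f : X ⟶ Y), Y.IsLE (b - n) ∧
      boundedFG A Y ∧ (∀ a : ℤ, a ≤ b - n → X.IsGE a → Y.IsGE a) ∧ IsLEApprox (b - n) f ∧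
      (kbProj A ⊓ thickRegular A).trW f := by
  induction n with
  | zero =>
    refine ⟨X, 𝟙 X, by simpa, hX, fun _ _ h => h, isLEApprox_id _ _, ?_⟩
    exact MorphismProperty.id_mem _ X
  | succ n ih =>
    obtain ⟨Y, f, h1, h2, h3, h4, h5⟩ := ih
    obtain ⟨Z, g, h1', h2', h3', h4', h5'⟩ := exists_isLEApprox_succ h2 (b - n)
    have e : b - (n + 1 : ℕ) = b - n - 1 := by push_cast; ring
    rw [e]
    exact ⟨Z, f ≫ g, h1', h2', fun a ha h => h3' a ha (h3 a (by lia) h),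
      h4.comp (by lia) h4', MorphismProperty.comp_mem _ _ _ h5 h5'⟩

lemma projective_of_hom_single_eq_zero {C : Type*} [Category* C] [Abelian C]
    [HasDerivedCategory.{w} C] {M : C}
    (h : ∀ (N : C) (f : (singleFunctor C 0).obj M ⟶ ((singleFunctor C 0).obj N)⟦(1 : ℤ)⟧), f = 0) :
    Projective M where
  factors {E X} f e he := by
    let S : ShortComplex C := ShortComplex.mk (kernel.ι e) e (kernel.condition e)
    have hS : S.ShortExact := { exact := ShortComplex.exact_kernel e }
    obtain ⟨g, hg⟩ := exists_eq_mor₂_comp hS.singleTriangle_distinguished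
      ((singleFunctor C 0).map f) (h _ _)
    obtain ⟨g, rfl⟩ := (singleFunctor C 0).map_surjective g
    exact ⟨g, (singleFunctor C 0).map_injective (by rw [hg, Functor.map_comp])⟩

/-- Over a left noetherian ring, a bounded object with finitely generated homology is perfect
provided it admits no nonzero morphisms to objects in sufficiently negative degrees. -/
lemma kbProj_of_hom_eq_zero {X : DerivedCategory (ModuleCat.{u} A)} (hX : boundedFG A X) (c : ℤ)
    (h : ∀ (Z : DerivedCategory (ModuleCat.{u} A)), Z.IsLE c → ∀ f : X ⟶ Z, f = 0) :
    kbProj A X := by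
  obtain ⟨⟨⟨a, ha⟩, b, hb⟩, _⟩ := id hX
  -- The bound by a concentrates Y in the single degree b - n; the bound by c makes X have no maps
  -- to Z⟦1⟧ for Z in D^{≤ b-n}.
  obtain ⟨n, hn, hn'⟩ : ∃ n : ℕ, b - n ≤ a ∧ b - n ≤ c :=
    ⟨(b - a).toNat + (b - c).toNat, by lia, by lia⟩
  obtain ⟨Y, f, h1, h2, h3, h4, h5⟩ := exists_isLEApprox hX b n
  generalize b - (n : ℤ) = m at *
  have h6 : Y.IsGE m := h3 m le_rfl (TStructure.t.isGE_of_ge _ m a)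
  refine (kbProj A).prop_of_trW_of_prop (ObjectProperty.trW_monotone inf_le_left _ h5) ?_
  have h7 : (Y⟦m⟧).IsLE 0 := TStructure.t.isLE_shift _ m m 0
  have h8 : (Y⟦m⟧).IsGE 0 := TStructure.t.isGE_shift _ m m 0
  obtain ⟨M, ⟨e⟩⟩ := exists_iso_singleFunctor_obj_of_isGE_of_isLE (Y⟦m⟧) 0
  rw [← (kbProj A).prop_shift_iff_of_isStableUnderShift Y m]
  refine (kbProj A).prop_of_iso e.symm (kbProj_single ⟨?_, ?_⟩ 0)
  · exact ModuleCat.finite_of_iso ((homologyFunctor _ 0).mapIso e ≪≫ homologySingleIso 0 M)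
      ((fgHomology A).le_shift m _ h2.2 0)
  · refine (IsProjective.iff_projective _).2 (projective_of_hom_single_eq_zero fun N g => ?_)
    -- A class g in Ext¹(M, N) becomes a map Y ⟶ Z⟦1⟧. Its composite with f is zero by `h`, and the
    -- cancellation property of f kills the map itself.
    let Z := ((singleFunctor (ModuleCat.{u} A) 0).obj N)⟦-m⟧
    have hZ : Z.IsLE m := TStructure.t.isLE_shift _ 0 (-m) m
    have hZ' : (Z⟦(1 : ℤ)⟧).IsLE c :=
      have := TStructure.t.isLE_of_le Z m (c + 1)
      TStructure.t.isLE_shift _ (c + 1) 1 c (by lia)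
    let i : (Z⟦(1 : ℤ)⟧)⟦m⟧ ≅ ((singleFunctor (ModuleCat.{u} A) 0).obj N)⟦(1 : ℤ)⟧ :=
      shiftComm Z 1 m ≪≫ (shiftFunctor _ (1 : ℤ)).mapIso
        ((shiftFunctorCompIsoId _ (-m) m (by lia)).app _)
    obtain ⟨k, hk⟩ := (shiftFunctor _ m).map_surjective (e.hom ≫ g ≫ i.inv)
    rw [h4.eq_zero Z hZ k (h _ hZ' _), Functor.map_zero] at hk
    rw [← cancel_epi e.hom, ← cancel_mono i.inv, Category.assoc, ← hk, comp_zero, zero_comp]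

lemma exists_hom_eq_zero_of_kbProj {A : Type u} [Ring A] [HasDerivedCategory.{w} (ModuleCat.{u} A)]
    {X : DerivedCategory (ModuleCat.{u} A)} (hX : kbProj A X) :
    ∃ c : ℤ, ∀ (Z : DerivedCategory (ModuleCat.{u} A)), Z.IsLE c → ∀ f : X ⟶ Z, f = 0 := by
  obtain ⟨K, hK, ⟨e⟩⟩ := hX
  have := isKProjective_of_isBoundedComplexIn A hK
  obtain ⟨_, a, b, _, _⟩ := hK
  refine ⟨a - 1, fun Z hZ f => ?_⟩
  rw [← cancel_epi e.inv, hom_eq_zero_of_isKProjective (show a - 1 < a by lia) (e.inv ≫ f),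
    comp_zero]

instance : (kbProj A).IsStableUnderRetracts where
  of_retract {X Y} r hY := by
    obtain ⟨c, hc⟩ := exists_hom_eq_zero_of_kbProj hY
    refine kbProj_of_hom_eq_zero
      ((boundedFG A).prop_of_retract r (boundedFG_of_dbMod (dbMod_of_kbProj hY))) c
      fun Z hZ f => ?_
    rw [← Category.id_comp f, ← r.retract, Category.assoc, hc Z hZ (r.r ≫ f), comp_zero]

/-- For X perfect, an approximation X ⟶ Y with Y low enough is zero, so X⟦1⟧ is a retract of a cone
built from free modules. This equality lets statements about perfect complexes be checked on the
regular module alone. -/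
lemma kbProj_eq_thickRegular : kbProj A = thickRegular A := by
  apply le_antisymm
  · intro X hX
    have hX' := boundedFG_of_dbMod (dbMod_of_kbProj hX)
    obtain ⟨c, hc⟩ := exists_hom_eq_zero_of_kbProj hX
    obtain ⟨⟨_, b, hb⟩, _⟩ := id hX'
    obtain ⟨Y, f, h1, h2, h3, h4, h5⟩ := exists_isLEApprox hX' b (b - c).toNat
    exact (thickRegular A).prop_of_trW_of_eq_zero
      (ObjectProperty.trW_monotone inf_le_right _ h5)
      (hc Y (TStructure.t.isLE_of_le _ (b - (b - c).toNat) c) f)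
  · rw [ObjectProperty.triangEnvelope_le_iff, ObjectProperty.singleton_le_iff]
    exact kbProj_single ⟨inferInstance, inferInstance⟩ 0

end DerivedCategory

/-! ### Localisation of modules and of Hom out of a free module -/

section

variable {R : Type u} [CommRing R] {Λ : Type u} [Ring Λ] [Algebra R Λ]

/-- The category of modules over an `R`-algebra is `R`-linear. -/
noncomputable instance algebraLinear : Linear R (ModuleCat.{u} Λ) :=
  letI (N : ModuleCat.{u} Λ) : Module R N := baseModule N
  haveI (N : ModuleCat.{u} Λ) : IsScalarTower R Λ N := baseModule_isScalarTower N
  { homModule := fun M N => inferInstance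
    smul_comp := fun X Y Z r f g => by ext; simp
    comp_smul := fun X Y Z f r g => by ext; simp }

attribute [local instance] baseModule baseModule_isScalarTower

variable (S : Submonoid R)

lemma locModule_smul (M : ModuleCat.{u} Λ) (r : R) (z : Localization S ⊗[R] M) :
    (letI z' : locModule S M := z; r • z') = (r • z : Localization S ⊗[R] M) :=
  LinearMap.congr_fun ((locAction S M).commutes r) z

instance : (locFunctor (Λ := Λ) S).Linear R where
  map_smul {M N} f r := by
    ext y
    refine (LinearMap.congr_fun (LinearMap.lTensor_smul (Localization S) r
      (f.hom.restrictScalars R)) y).trans ?_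
    exact (locModule_smul S N r _).symm

/-- The localisation of a free module of rank one is free of rank one. -/
noncomputable def locFreeEquiv {M : ModuleCat.{u} Λ} (e : M ≃ₗ[Λ] Λ) :
    (locFunctor S).obj M ≃ₗ[LocAlg Λ S] LocAlg Λ S :=
  let e' : Localization S ⊗[R] M ≃ₗ[R] Localization S ⊗[R] Λ :=
    LinearEquiv.lTensor (Localization S) (e.restrictScalars R)
  { toFun := e'
    invFun := e'.symm
    left_inv := e'.left_inv
    right_inv := e'.right_inv
    map_add' := e'.map_add
    map_smul' := fun c z => by
      change e' (locAction S _ c z) = c * e' z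
      change Localization S ⊗[R] M at z
      induction c using TensorProduct.induction_on with
      | zero => simp
      | add c d hc hd => simp only [map_add, LinearMap.add_apply, hc, hd, add_mul]
      | tmul a x =>
        induction z using TensorProduct.induction_on with
        | zero => simp
        | add y z hy hz => simp only [map_add, hy, hz, mul_add]
        | tmul b m => simp [locAction_tmul, e'] }

lemma locFunctor_hom_ext {M : ModuleCat.{u} Λ} (e : M ≃ₗ[Λ] Λ) {N : ModuleCat.{u} (LocAlg Λ S)}
    {f g : (locFunctor S).obj M ⟶ N}
    (h : f ((1 : Localization S) ⊗ₜ[R] e.symm 1 : Localization S ⊗[R] M) =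
      g ((1 : Localization S) ⊗ₜ[R] e.symm 1 : Localization S ⊗[R] M)) : f = g := by
  rw [← cancel_epi (locFreeEquiv S e).symm.toModuleIso.hom]
  ext
  exact h

/-- A map out of M is its value at the generator, and N ⟶ R_S ⊗ N is a localisation of R-modules. An
abstract M with `e` is allowed because the application has M = H⁰ of the regular object. -/
lemma exists_smul_eq_zero_of_locFunctor_map_eq_zero {M N : ModuleCat.{u} Λ} (e : M ≃ₗ[Λ] Λ)
    (f : M ⟶ N) (hf : (locFunctor S).map f = 0) : ∃ s ∈ S, s • f = 0 := by
  have h : TensorProduct.mk R (Localization S) N 1 (f (e.symm 1)) = 0 :=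
    congr_arg (fun g => g ((1 : Localization S) ⊗ₜ[R] e.symm 1 : Localization S ⊗[R] M)) hf
  obtain ⟨s, hs⟩ := (IsLocalizedModule.eq_zero_iff S _).1 h
  refine ⟨s, s.2, ?_⟩
  rw [← cancel_epi e.symm.toModuleIso.hom]
  ext
  exact hs

lemma exists_smul_eq_locFunctor_map {M N : ModuleCat.{u} Λ} (e : M ≃ₗ[Λ] Λ)
    (g : (locFunctor S).obj M ⟶ (locFunctor S).obj N) :
    ∃ s ∈ S, ∃ f : M ⟶ N, (locFunctor S).map f = s • g := by
  obtain ⟨⟨n, s⟩, hn⟩ := IsLocalizedModule.surj S (TensorProduct.mk R (Localization S) N 1)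
    (g ((1 : Localization S) ⊗ₜ[R] e.symm 1 : Localization S ⊗[R] M))
  refine ⟨s, s.2, ModuleCat.ofHom (LinearMap.toSpanSingleton Λ N n ∘ₗ e.toLinearMap),
    locFunctor_hom_ext S e ?_⟩
  refine (LinearMap.lTensor_tmul _ _ _ _).trans
    (Eq.trans ?_ ((locModule_smul S N s _).trans hn).symm)
  simp

lemma fgProj_locFunctor {M : ModuleCat.{u} Λ} (hM : fgProj Λ M) :
    fgProj (LocAlg Λ S) ((locFunctor S).obj M) := by
  obtain ⟨k, φ, hφ⟩ := exists_fgProj_epi M hM.1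
  have : Projective M := (IsProjective.iff_projective M).1 hM.2
  let e : (locFunctor S).obj (⨁ fun _ : Fin k => ModuleCat.of Λ Λ) ≅
    ⨁ fun _ : Fin k => ModuleCat.of (LocAlg Λ S) (LocAlg Λ S) :=
      (locFunctor S).mapBiproduct _ ≪≫ Limits.biproduct.mapIso fun _ =>
        (locFreeEquiv S (LinearEquiv.refl Λ Λ)).toModuleIso
  let r : Retract M _ := ⟨Projective.factorThru (𝟙 M) φ, φ, Projective.factorThru_comp _ _⟩
  obtain ⟨h1, h2⟩ := fgProj_biproduct (A := LocAlg Λ S) k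
  let r' := (r.map (locFunctor S)).trans e.retract
  have := r'.splitEpi.epi
  exact ⟨ModuleCat.finite_of_epi r'.r h1, Module.Projective.of_split r'.i.hom r'.r.hom
    (by rw [← ModuleCat.hom_comp, r'.retract]; rfl)⟩

end

/-! ### Exact functors, homology and R-linearity -/

namespace HomologicalComplex

variable {C₁ C₂ : Type*} [Category* C₁] [Category* C₂] [Abelian C₁] [Abelian C₂] (G : C₁ ⥤ C₂)
  [G.Additive] [Limits.PreservesFiniteLimits G] [Limits.PreservesFiniteColimits G]

/-- An exact functor commutes with the homology of complexes. -/
noncomputable def mapHomologyFunctorIso {ι : Type*} (c : ComplexShape ι) (i : ι) :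
    G.mapHomologicalComplex c ⋙ homologyFunctor C₂ c i ≅ homologyFunctor C₁ c i ⋙ G :=
  NatIso.ofComponents (fun K => (K.sc i).mapHomologyIso G)
    (fun f => ShortComplex.mapHomologyIso_hom_naturality ((shortComplexFunctor C₁ c i).map f) G)

instance (R : Type*) [Ring R] [Linear R C₁] {ι : Type*} (c : ComplexShape ι) (i : ι) :
    (homologyFunctor C₁ c i).Linear R where
  map_smul f r := ShortComplex.homologyMap_smul ((shortComplexFunctor C₁ c i).map f) r

end HomologicalComplex

namespace DerivedCategory

variable {C₁ C₂ : Type*} [Category* C₁] [Category* C₂] [Abelian C₁] [Abelian C₂] (G : C₁ ⥤ C₂)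
  [G.Additive] [Limits.PreservesFiniteLimits G] [Limits.PreservesFiniteColimits G]
  [HasDerivedCategory.{w} C₁] [HasDerivedCategory.{w'} C₂]

/-- The functor induced by an exact functor on derived categories commutes with homology. -/
noncomputable def mapDerivedCategoryHomologyIso (n : ℤ) :
    G.mapDerivedCategory ⋙ homologyFunctor C₂ n ≅ homologyFunctor C₁ n ⋙ G :=
  Localization.liftNatIso Q (HomologicalComplex.quasiIso C₁ (.up ℤ))
    (Q ⋙ G.mapDerivedCategory ⋙ homologyFunctor C₂ n) (Q ⋙ homologyFunctor C₁ n ⋙ G) _ _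
    (Functor.isoWhiskerRight G.mapDerivedCategoryFactors (homologyFunctor C₂ n) ≪≫
      Functor.isoWhiskerLeft (G.mapHomologicalComplex _) (homologyFunctorFactors C₂ n) ≪≫
      HomologicalComplex.mapHomologyFunctorIso G (.up ℤ) n ≪≫
      Functor.isoWhiskerRight (homologyFunctorFactors C₁ n).symm G)

variable (R : Type*) [Ring R] [Linear R C₁]

instance (n : ℤ) : (homologyFunctor C₁ n).Linear R := by
  have : (Q ⋙ homologyFunctor C₁ n).Linear R :=
    Functor.linear_of_iso _ (homologyFunctorFactors C₁ n).symm
  rw [← Localization.functor_linear_iff Q (HomologicalComplex.quasiIso C₁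
    (.up ℤ)) R (Q ⋙ homologyFunctor C₁ n)]
  infer_instance

end DerivedCategory

/-! ### Objects whose outgoing morphisms localise form a thick subcategory -/

namespace CategoryTheory.Functor

open Limits Pretriangulated

variable {T T' : Type*} [Category* T] [Preadditive T] [Category* T'] [Preadditive T']
  {R : Type*} [CommRing R] [CategoryTheory.Linear R T] [CategoryTheory.Linear R T']
  (F : T ⥤ T') (S : Submonoid R)

/-- The morphisms `X ⟶ Y` sent to zero by `F` are annihilated by an element of `S`. -/
def HomLocalizationInjective (X Y : T) : Prop :=
  ∀ f : X ⟶ Y, F.map f = 0 → ∃ s ∈ S, s • f = 0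

/-- The morphisms `F X ⟶ F Y` become images of morphisms `X ⟶ Y` after multiplication by an
element of `S`. -/
def HomLocalizationSurjective (X Y : T) : Prop :=
  ∀ g : F.obj X ⟶ F.obj Y, ∃ s ∈ S, ∃ f : X ⟶ Y, F.map f = s • g

/-- The objects `X` such that `F` localizes all morphisms with source `X`. -/
def homLocalized : ObjectProperty T := fun X =>
  ∀ Y, F.HomLocalizationInjective S X Y ∧ F.HomLocalizationSurjective S X Y

lemma HomLocalizationInjective.of_iso {X Y Y' : T} (h : F.HomLocalizationInjective S X Y)
    (e : Y ≅ Y') : F.HomLocalizationInjective S X Y' := by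
  intro f hf
  obtain ⟨s, hs, h⟩ := h (f ≫ e.inv) (by rw [F.map_comp, hf, zero_comp])
  refine ⟨s, hs, ?_⟩
  rw [← cancel_mono e.inv, Linear.smul_comp, h, zero_comp]

lemma HomLocalizationSurjective.of_iso {X Y Y' : T} (h : F.HomLocalizationSurjective S X Y)
    (e : Y ≅ Y') : F.HomLocalizationSurjective S X Y' := by
  intro g
  obtain ⟨s, hs, f, hf⟩ := h (g ≫ F.map e.inv)
  refine ⟨s, hs, f ≫ e.hom, ?_⟩
  rw [F.map_comp, hf, Linear.smul_comp, Category.assoc, ← F.map_comp, e.inv_hom_id, F.map_id,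
    Category.comp_id]

instance : (F.homLocalized S).IsStableUnderRetracts where
  of_retract {X X'} r h Y := by
    refine ⟨fun f hf => ?_, fun g => ?_⟩
    · obtain ⟨s, hs, h⟩ := (h Y).1 (r.r ≫ f) (by rw [F.map_comp, hf, comp_zero])
      refine ⟨s, hs, ?_⟩
      rw [← Category.id_comp f, ← r.retract, Category.assoc, ← Linear.comp_smul, h, comp_zero]
    · obtain ⟨s, hs, f, h⟩ := (h Y).2 (F.map r.r ≫ g)
      refine ⟨s, hs, r.i ≫ f, ?_⟩
      rw [F.map_comp, h, Linear.comp_smul, ← Category.assoc, ← F.map_comp, r.retract, F.map_id,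
        Category.id_comp]

variable [HasShift T ℤ] [HasShift T' ℤ] [F.CommShift ℤ]

lemma map_shift_eq_zero_iff [∀ n : ℤ, (shiftFunctor T' n).Additive] {X Y : T} (f : X ⟶ Y) (n : ℤ) :
    F.map (f⟦n⟧') = 0 ↔ F.map f = 0 := by
  rw [← cancel_mono ((F.commShiftIso n).hom.app Y), zero_comp, F.commShiftIso_hom_naturality,
    ← cancel_epi ((F.commShiftIso n).inv.app X), comp_zero, Iso.inv_hom_id_app_assoc]
  exact ⟨fun h => (shiftFunctor T' n).map_injective (h.trans ((shiftFunctor T' n).map_zero _ _).symm),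
    fun h => h ▸ (shiftFunctor T' n).map_zero _ _⟩

lemma HomLocalizationSurjective.shift [∀ n : ℤ, Functor.Linear R (shiftFunctor T' n)]
    {X Y : T} (h : F.HomLocalizationSurjective S X Y) (n : ℤ) :
    F.HomLocalizationSurjective S (X⟦n⟧) (Y⟦n⟧) := by
  intro g
  obtain ⟨g', hg'⟩ := (shiftFunctor T' n).map_surjective
    ((F.commShiftIso n).inv.app X ≫ g ≫ (F.commShiftIso n).hom.app Y)
  obtain ⟨s, hs, f, hf⟩ := h g'
  refine ⟨s, hs, f⟦n⟧', ?_⟩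
  rw [← cancel_mono ((F.commShiftIso n).hom.app Y), F.commShiftIso_hom_naturality, hf,
    Functor.map_smul, hg', Linear.comp_smul, Iso.hom_inv_id_app_assoc, Linear.smul_comp]

variable [HasZeroObject T] [∀ n : ℤ, (shiftFunctor T n).Additive] [Pretriangulated T]
  [HasZeroObject T'] [∀ n : ℤ, (shiftFunctor T' n).Additive] [Pretriangulated T']
  [∀ n : ℤ, Functor.Linear R (shiftFunctor T n)] [∀ n : ℤ, Functor.Linear R (shiftFunctor T' n)]
  [F.IsTriangulated] [F.Linear R]

lemma HomLocalizationInjective.shift {X Y : T} (h : F.HomLocalizationInjective S X Y) (n : ℤ) :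
    F.HomLocalizationInjective S (X⟦n⟧) (Y⟦n⟧) := by
  intro f hf
  obtain ⟨f, rfl⟩ := (shiftFunctor T n).map_surjective f
  obtain ⟨s, hs, hf'⟩ := h f ((F.map_shift_eq_zero_iff f n).1 hf)
  exact ⟨s, hs, by rw [← Functor.map_smul, hf', Functor.map_zero]⟩

/-- A five-lemma chase on the long exact sequences of Hom(-, W), collecting one denominator per
step. -/
lemma homLocalized_ext₂ {X Y Z : T} {f : X ⟶ Y} {g : Y ⟶ Z} {h : Z ⟶ X⟦(1 : ℤ)⟧}
    (hT : Triangle.mk f g h ∈ distTriang T) (hX : F.homLocalized S X)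
    (hX' : F.homLocalized S (X⟦(1 : ℤ)⟧)) (hZ : F.homLocalized S Z) : F.homLocalized S Y := by
  intro W
  have hT' : Triangle.mk (F.map f) (F.map g) (F.map h ≫ (F.commShiftIso (1 : ℤ)).hom.app X) ∈
    distTriang T' := F.map_distinguished _ hT
  refine ⟨fun k hk => ?_, fun k => ?_⟩
  · obtain ⟨s, hs, h1⟩ := (hX W).1 (f ≫ k) (by rw [F.map_comp, hk, comp_zero])
    obtain ⟨l, hl⟩ := exists_eq_comp_mor₂ hT (s • k) (by rw [Linear.comp_smul, h1])
    -- F l need not vanish: it may come from F X⟦1⟧. That part is lifted up to a denominator to m',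
    -- and `h ≫ m'` is invisible after composing with g.
    obtain ⟨m, hm⟩ := exists_eq_comp_mor₃ hT' (F.map l)
      (by rw [← F.map_comp, ← hl, Functor.map_smul, hk, smul_zero])
    obtain ⟨t, ht, m', hm'⟩ := (hX' W).2 ((F.commShiftIso (1 : ℤ)).hom.app X ≫ m)
    obtain ⟨r, hr, h2⟩ := (hZ W).1 (t • l - h ≫ m') (by
      rw [F.map_sub, Functor.map_smul, F.map_comp, hm', hm, Linear.comp_smul, Category.assoc,
        sub_self])
    refine ⟨r * (t * s), S.mul_mem hr (S.mul_mem ht hs), ?_⟩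
    have h3 : g ≫ h = 0 := comp_distTriang_mor_zero₂₃ _ hT
    have h4 := congr_arg (fun z => g ≫ z) h2
    simp only [Linear.comp_smul, Preadditive.comp_sub, ← hl, reassoc_of% h3, zero_comp, sub_zero,
      comp_zero] at h4
    rw [mul_smul, mul_smul, h4]
  · obtain ⟨s, hs, l, hl⟩ := (hX W).2 (F.map f ≫ k)
    have h3 : h ≫ f⟦(1 : ℤ)⟧' = 0 := comp_distTriang_mor_zero₃₁ _ hT
    -- `h ≫ l⟦1⟧'` is the obstruction to extending l along f. Its image under F vanishes because F l
    -- already extends, up to the factor s.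
    obtain ⟨t, ht, h1⟩ := (hZ (W⟦(1 : ℤ)⟧)).1 (h ≫ l⟦(1 : ℤ)⟧') (by
      rw [← cancel_mono ((F.commShiftIso (1 : ℤ)).hom.app W), F.map_comp, Category.assoc,
        F.commShiftIso_hom_naturality, hl, Functor.map_smul, Functor.map_comp, Linear.comp_smul,
        Linear.comp_smul, ← F.commShiftIso_hom_naturality_assoc, ← F.map_comp_assoc, h3,
        Functor.map_zero, zero_comp, smul_zero, zero_comp])
    obtain ⟨l', hl'⟩ := exists_eq_comp_mor₁ hT (t • l)
      (by rw [Functor.map_smul, Linear.comp_smul, h1])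
    obtain ⟨m, hm⟩ := exists_eq_comp_mor₂ hT' (F.map l' - (t * s) • k) (by
      rw [Preadditive.comp_sub, ← F.map_comp, ← hl', Functor.map_smul, hl, Linear.comp_smul,
        mul_smul, sub_self])
    obtain ⟨r, hr, m', hm'⟩ := (hZ W).2 m
    refine ⟨r * (t * s), S.mul_mem hr (S.mul_mem ht hs), r • l' - g ≫ m', ?_⟩
    rw [F.map_sub, Functor.map_smul, F.map_comp, hm', Linear.comp_smul, ← hm, mul_smul r, smul_sub,
      sub_sub_cancel]

lemma homLocalized_shift {X : T} (hX : F.homLocalized S X) (n : ℤ) :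
    F.homLocalized S (X⟦n⟧) := fun Y =>
  let e : (Y⟦-n⟧)⟦n⟧ ≅ Y := (shiftFunctorCompIsoId T (-n) n (by lia)).app Y
  ⟨((hX (Y⟦-n⟧)).1.shift F S n).of_iso F S e, ((hX (Y⟦-n⟧)).2.shift F S n).of_iso F S e⟩

instance : (F.homLocalized S).IsTriangulated where
  exists_zero := ⟨0, isZero_zero _, fun _ =>
    ⟨fun _ _ => ⟨1, S.one_mem, (isZero_zero T).eq_of_src _ _⟩,
      fun _ => ⟨1, S.one_mem, 0, (F.map_isZero (isZero_zero T)).eq_of_src _ _⟩⟩⟩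
  isStableUnderShiftBy n :=
    { le_shift := fun _ hX => F.homLocalized_shift S hX n }
  ext₂' Δ hΔ h₁ h₃ := ObjectProperty.le_isoClosure _ _
    (F.homLocalized_ext₂ S (f := Δ.mor₁) (g := Δ.mor₂) (h := Δ.mor₃) hΔ h₁
      (F.homLocalized_shift S h₁ 1) h₃)

end CategoryTheory.Functor

/-! ### The localisation functor on derived categories -/

noncomputable section

namespace DerivedCategory

open Limits Pretriangulated

lemma isLE_mapDerivedCategory {C₁ C₂ : Type*} [Category* C₁] [Category* C₂] [Abelian C₁]
    [Abelian C₂] (G : C₁ ⥤ C₂) [G.Additive] [PreservesFiniteLimits G] [PreservesFiniteColimits G]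
    [HasDerivedCategory.{w} C₁] [HasDerivedCategory.{w'} C₂] (X : DerivedCategory C₁) (n : ℤ)
    [X.IsLE n] : (G.mapDerivedCategory.obj X).IsLE n := by
  rw [isLE_iff]
  exact fun i hi => IsZero.of_iso (G.map_isZero (isZero_of_isLE X n i hi))
    ((mapDerivedCategoryHomologyIso G i).app X)

variable {R : Type u} [CommRing R] {Λ : Type u} [Ring Λ] [Algebra R Λ] (S : Submonoid R)

lemma smul_eq_zero_of_isUnit [HasDerivedCategory.{w} (ModuleCat.{u} Λ)]
    {X Y : DerivedCategory (ModuleCat.{u} Λ)} {r : R} (hr : IsUnit (algebraMap R Λ r))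
    (f : X ⟶ Y) (hf : r • f = 0) : f = 0 := by
  -- Isomorphisms are detected on homology, where r acts through a unit of Λ.
  have : IsIso (r • 𝟙 X) := by
    rw [isIso_iff]
    intro n
    rw [Functor.map_smul, CategoryTheory.Functor.map_id, ConcreteCategory.isIso_iff_bijective]
    exact hr.smul_bijective
  rw [← cancel_epi (r • 𝟙 X), comp_zero, Linear.smul_comp, Category.id_comp, hf]

lemma isUnit_algebraMap_locAlg {s : R} (hs : s ∈ S) :
    IsUnit (algebraMap R (LocAlg Λ S) s) := by
  have := (IsLocalization.map_units (Localization S) (⟨s, hs⟩ : S)).map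
    (algebraMap (Localization S) (LocAlg Λ S))
  rwa [← IsScalarTower.algebraMap_apply] at this

variable [HasDerivedCategory.{w} (ModuleCat.{u} Λ)]
  [HasDerivedCategory.{w'} (ModuleCat.{u} (LocAlg Λ S))]

variable (Λ) in
/-- The localisation functor `D(Mod Λ) ⥤ D(Mod Λ_S)`. -/
abbrev locDerived :
    DerivedCategory (ModuleCat.{u} Λ) ⥤ DerivedCategory (ModuleCat.{u} (LocAlg Λ S)) :=
  (locFunctor S).mapDerivedCategory

lemma kbProj_locDerived {X : DerivedCategory (ModuleCat.{u} Λ)} (hX : kbProj Λ X) :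
    kbProj (LocAlg Λ S) ((locDerived Λ S).obj X) := by
  obtain ⟨K, ⟨hK, a, b, _, _⟩, ⟨e⟩⟩ := hX
  refine ⟨((locFunctor S).mapHomologicalComplex (.up ℤ)).obj K,
    ⟨fun n => fgProj_locFunctor S (hK n), a, b, ?_, ?_⟩,
    ⟨(locDerived Λ S).mapIso e ≪≫ (locFunctor S).mapDerivedCategoryFactors.app K⟩⟩
  · rw [CochainComplex.isStrictlyGE_iff]
    exact fun i hi => (locFunctor S).map_isZero (K.isZero_of_isStrictlyGE a i hi)
  · rw [CochainComplex.isStrictlyLE_iff]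
    exact fun i hi => (locFunctor S).map_isZero (K.isZero_of_isStrictlyLE b i hi)

variable (Λ) in
/-- The localisation of the regular module is the regular module. -/
def locDerivedRegularIso : (locDerived Λ S).obj (regular Λ) ≅ regular (LocAlg Λ S) :=
  ((locFunctor S).mapDerivedCategorySingleFunctor 0).app (ModuleCat.of Λ Λ) ≪≫
    (singleFunctor _ 0).mapIso (locFreeEquiv S (LinearEquiv.refl Λ Λ)).toModuleIso

variable (Λ) in
-- Morphisms out of the regular object are determined by their effect on H⁰, on both sides, and H⁰
-- commutes with localisation; this reduces the claim to modules.
lemma homLocalized_regular : (locDerived Λ S).homLocalized S (regular Λ) := by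
  have : Projective (ModuleCat.of Λ Λ) := (IsProjective.iff_projective (ModuleCat.of Λ Λ)).1
    (inferInstanceAs (Module.Projective Λ Λ))
  have : Projective (ModuleCat.of (LocAlg Λ S) (LocAlg Λ S)) :=
    (IsProjective.iff_projective (ModuleCat.of (LocAlg Λ S) (LocAlg Λ S))).1
    (inferInstanceAs (Module.Projective (LocAlg Λ S) (LocAlg Λ S)))
  have hz {Z : DerivedCategory (ModuleCat.{u} (LocAlg Λ S))}
      (g : (locDerived Λ S).obj (regular Λ) ⟶ Z)
      (hg : (homologyFunctor _ 0).map g = 0) : g = 0 := by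
    rw [← cancel_epi (locDerivedRegularIso Λ S).inv, comp_zero]
    exact hom_from_single_eq_zero _ (by rw [Functor.map_comp, hg, comp_zero])
  let e : (homologyFunctor (ModuleCat.{u} Λ) 0).obj (regular Λ) ≃ₗ[Λ] Λ :=
    (homologySingleIso 0 (ModuleCat.of Λ Λ)).toLinearEquiv
  let ε := mapDerivedCategoryHomologyIso (locFunctor (Λ := Λ) S) 0
  intro Y
  have nat (f : regular Λ ⟶ Y) : (homologyFunctor _ 0).map ((locDerived Λ S).map f) ≫ ε.hom.app Y =
    ε.hom.app (regular Λ) ≫ (locFunctor S).map ((homologyFunctor _ 0).map f) := ε.hom.naturality f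
  refine ⟨fun f hf => ?_, fun g => ?_⟩
  · obtain ⟨s, hs, h⟩ := exists_smul_eq_zero_of_locFunctor_map_eq_zero S e
      ((homologyFunctor _ 0).map f) (by
        rw [← cancel_epi (ε.hom.app (regular Λ)), ← nat, hf, Functor.map_zero, zero_comp, comp_zero])
    exact ⟨s, hs, hom_from_single_eq_zero _ (by rw [Functor.map_smul]; exact h)⟩
  · obtain ⟨s, hs, φ, h⟩ := exists_smul_eq_locFunctor_map S e
      (ε.inv.app (regular Λ) ≫ (homologyFunctor _ 0).map g ≫ ε.hom.app Y)
    obtain ⟨f, rfl⟩ := exists_hom_from_single φ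
    refine ⟨s, hs, f, sub_eq_zero.1 (hz _ ?_)⟩
    rw [Functor.map_sub, Functor.map_smul, sub_eq_zero, ← cancel_mono (ε.hom.app Y), nat]
    refine (congr_arg (fun z => ε.hom.app (regular Λ) ≫ z) h).trans ?_
    simp only [Linear.comp_smul, Linear.smul_comp]
    congr 1
    exact ε.hom_inv_id_app_assoc _ _

lemma homLocalized_of_kbProj [IsNoetherianRing Λ] {X : DerivedCategory (ModuleCat.{u} Λ)}
    (hX : kbProj Λ X) : (locDerived Λ S).homLocalized S X := by
  rw [kbProj_eq_thickRegular] at hX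
  refine ((ObjectProperty.triangEnvelope_le_iff _).2 ?_) X hX
  rintro _ ⟨⟩
  exact homLocalized_regular Λ S

end DerivedCategory

/-- If the members of a sequence of successive composites become zero locally on `Spec R`, then one
of them is zero. -/
lemma CategoryTheory.exists_eq_zero_of_locally {T : Type*} [Category* T] [Preadditive T]
    {R : Type*} [CommRing R] [IsNoetherianRing R] [Linear R T] {X : T} (Y : ℕ → T)
    (f : ∀ n, X ⟶ Y n) (hf : ∀ n, ∃ h : Y n ⟶ Y (n + 1), f n ≫ h = f (n + 1))
    (h : ∀ p : PrimeSpectrum R, ∃ n, ∃ s ∈ p.asIdeal.primeCompl, s • f n = 0) :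
    ∃ n, f n = 0 := by
  let I (n : ℕ) : Ideal R := LinearMap.ker (LinearMap.toSpanSingleton R (X ⟶ Y n) (f n))
  have hI {n : ℕ} {s : R} : s ∈ I n ↔ s • f n = 0 := LinearMap.mem_ker
  have mono : Monotone I := monotone_nat_of_le_succ fun n s hs => by
    obtain ⟨h, hh⟩ := hf n
    rw [hI] at hs ⊢
    rw [← hh, ← Linear.smul_comp, hs, Limits.zero_comp]
  obtain ⟨n, hn⟩ := monotone_stabilizes_iff_noetherian.2 (inferInstanceAs (IsNoetherian R R))
    ⟨I, mono⟩
  refine ⟨n, ?_⟩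
  -- For each maximal ideal some I m contains an element outside it; that element lies in I n, by
  -- stability if n ≤ m and by monotonicity otherwise.
  have h1 : (1 : R) ∈ I n := by
    by_contra h1
    obtain ⟨p, hp, hpI⟩ := Ideal.exists_le_maximal (I n) ((Ideal.ne_top_iff_one _).2 h1)
    obtain ⟨m, s, hs, hsm⟩ := h ⟨p, hp.isPrime⟩
    refine hs (hpI ?_)
    rcases le_total n m with hnm | hnm
    · exact (hn m hnm).ge (hI.2 hsm)
    · exact mono hnm (hI.2 hsm)
  rw [← one_smul R (f n), ← hI]
  exact h1

/-! ### Perfectness is a local property -/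

namespace DerivedCategory

open Limits Pretriangulated

section

variable {R : Type u} [CommRing R] {Λ : Type u} [Ring Λ] [Algebra R Λ] (S : Submonoid R)
  [HasDerivedCategory.{w} (ModuleCat.{u} Λ)]

section

variable [HasDerivedCategory.{w'} (ModuleCat.{u} (LocAlg Λ S))]

lemma homLocalizationInjective_of_boundedFG [IsNoetherianRing Λ]
    {X Y : DerivedCategory (ModuleCat.{u} Λ)} (hX : boundedFG Λ X) (a : ℤ) [Y.IsGE a] :
    (locDerived Λ S).HomLocalizationInjective S X Y := by
  intro k hk
  obtain ⟨⟨_, b, _⟩, _⟩ := id hX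
  -- This many steps push Z into degrees below a, so Hom(Z, Y) = 0 and a morphism X ⟶ Y is
  -- determined by its restriction to the perfect object Q.
  obtain ⟨Z, f, _, _, _, _, hf⟩ := exists_isLEApprox hX b (b - a + 1).toNat
  obtain ⟨Q, g, h, hT, hQ⟩ := ((kbProj Λ).trW_iff' f).1
    (ObjectProperty.trW_monotone inf_le_left _ hf)
  obtain ⟨s, hs, h1⟩ := (homLocalized_of_kbProj S hQ Y).1 (g ≫ k)
    (by rw [Functor.map_comp, hk, comp_zero])
  obtain ⟨t, ht⟩ := exists_eq_comp_mor₂ hT (s • k) (by rw [Linear.comp_smul, h1])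
  refine ⟨s, hs, ?_⟩
  rw [ht, TStructure.t.zero t (b - (b - a + 1).toNat) a (by lia), comp_zero]

end

variable [IsNoetherianRing R] [IsNoetherianRing Λ]
  [∀ p : PrimeSpectrum R,
      HasDerivedCategory.{w'} (ModuleCat.{u} (LocAlg Λ p.asIdeal.primeCompl))]

lemma kbProj_of_locAtPrime {X : DerivedCategory (ModuleCat.{u} Λ)} (hX : boundedFG Λ X)
    (h : ∀ p : PrimeSpectrum R, kbProj (LocAlg Λ p.asIdeal.primeCompl) (locAtPrime p X)) :
    kbProj Λ X := by
  obtain ⟨⟨_, b, _⟩, _⟩ := id hX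
  choose Y f hLE hY _ hf _ using exists_isLEApprox hX b
  obtain ⟨n, hn⟩ := exists_eq_zero_of_locally (R := R) Y f
    (fun n => (hf n).exists_factor _ (TStructure.t.isLE_of_le _ (b - (n + 1 : ℕ)) _ (by lia)) _)
    (fun p => by
      -- As soon as b - n ≤ c, the localised Y n lies where X_𝔭 has no nonzero morphisms.
      obtain ⟨c, hc⟩ := exists_hom_eq_zero_of_kbProj (h p)
      obtain ⟨n, hn⟩ : ∃ n : ℕ, b - n ≤ c := ⟨(b - c).toNat, by lia⟩
      obtain ⟨⟨⟨a, _⟩, _⟩, _⟩ := hY n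
      have : (Y n).IsLE c := TStructure.t.isLE_of_le _ (b - n) c hn
      exact ⟨n, homLocalizationInjective_of_boundedFG _ hX a (f n)
        (hc _ (isLE_mapDerivedCategory _ _ c) _)⟩)
  refine kbProj_of_hom_eq_zero hX (b - n) fun Z hZ g => ?_
  obtain ⟨g', rfl⟩ := (hf n).exists_factor Z hZ g
  rw [hn, zero_comp]

end

end DerivedCategory

/-! ### Silting in full subcategories and the ghost lemma -/

noncomputable section

section

open Limits Pretriangulated

variable {T T' : Type*} [Category* T] [Preadditive T] [HasZeroObject T] [HasShift T ℤ]
  [∀ n : ℤ, (shiftFunctor T n).Additive] [Pretriangulated T]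
  [Category* T'] [Preadditive T'] [HasZeroObject T'] [HasShift T' ℤ]
  [∀ n : ℤ, (shiftFunctor T' n).Additive] [Pretriangulated T']

instance CategoryTheory.ObjectProperty.isStableUnderRetracts_inverseImage {C D : Type*}
    [Category* C] [Category* D] (P : ObjectProperty D) [P.IsStableUnderRetracts] (F : C ⥤ D) :
    (P.inverseImage F).IsStableUnderRetracts where
  of_retract r h := P.prop_of_retract (r.map F) h

lemma CategoryTheory.ObjectProperty.triangEnvelope_singleton_self (X : T) :
    (ObjectProperty.singleton X).triangEnvelope X :=
  ObjectProperty.singleton_le_iff.1 (ObjectProperty.le_triangEnvelope _)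

lemma isPresilting_obj_iff (F : T ⥤ T') [F.CommShift ℤ] [F.Full] [F.Faithful]
    [F.PreservesZeroMorphisms] (X : T) : IsPresilting (F.obj X) ↔ IsPresilting X := by
  refine ⟨fun h i hi f => F.map_injective ?_, fun h i hi g => ?_⟩
  · rw [F.map_zero, ← cancel_mono ((F.commShiftIso i).hom.app X), zero_comp]
    exact h i hi _
  · obtain ⟨f, hf⟩ := F.map_surjective (g ≫ (F.commShiftIso i).inv.app X)
    rw [← cancel_mono ((F.commShiftIso i).inv.app X), zero_comp, ← hf, h i hi f, F.map_zero]

/-- Since P is thick in T, the thick closure of X formed inside P is also thick in T, so both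
closures agree and generation can be tested in the ambient category. -/
lemma isSilting_fullSubcategory_iff [IsTriangulated T] (P : ObjectProperty T) [P.IsTriangulated]
    [P.IsStableUnderRetracts] {X : T} (hX : P X) :
    IsSilting (⟨X, hX⟩ : P.FullSubcategory) ↔
      IsPresilting X ∧ P ≤ (ObjectProperty.singleton X).triangEnvelope := by
  refine and_congr (isPresilting_obj_iff P.ι ⟨X, hX⟩).symm ⟨fun h Y hY => ?_, fun h => ?_⟩
  · have : (⊤ : ObjectProperty P.FullSubcategory) ≤
        (ObjectProperty.singleton X).triangEnvelope.inverseImage P.ι := by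
      rw [← h, ObjectProperty.triangEnvelope_le_iff, ObjectProperty.singleton_le_iff]
      exact ObjectProperty.triangEnvelope_singleton_self X
    exact this ⟨Y, hY⟩ trivial
  · let E := (ObjectProperty.singleton (⟨X, hX⟩ : P.FullSubcategory)).triangEnvelope
    have : (E.map P.ι).IsStableUnderRetracts :=
      { of_retract := by
          rintro Y Z r ⟨W, hW, ⟨e⟩⟩
          let r' : Retract Y (P.ι.obj W) := r.trans e.symm.retract
          have hY : P Y := P.prop_of_retract r' W.2
          let r'' : Retract (⟨Y, hY⟩ : P.FullSubcategory) W :=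
            { i := P.ι.preimage r'.i
              r := P.ι.preimage r'.r
              retract := P.ι.map_injective (by
                rw [Functor.map_comp, Functor.map_preimage, Functor.map_preimage,
                  CategoryTheory.Functor.map_id]
                exact r'.retract) }
          exact ⟨⟨Y, hY⟩, E.prop_of_retract r'' hW, ⟨Iso.refl _⟩⟩ }
    have hE : (ObjectProperty.singleton X).triangEnvelope ≤ E.map P.ι := by
      rw [ObjectProperty.triangEnvelope_le_iff]
      rintro _ ⟨⟩
      exact ⟨_, ObjectProperty.triangEnvelope_singleton_self _,
        ⟨Iso.refl _⟩⟩
    refine top_le_iff.1 fun Y _ => ?_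
    obtain ⟨W, hW, ⟨e⟩⟩ := hE _ (h _ Y.2)
    exact E.prop_of_iso (P.ι.preimageIso e) hW

/-- The objects `Z` such that, for some `n`, every morphism from a shift of `Z` to a term of the
sequence `Φ` becomes zero after `n` steps. -/
def eventuallyGhost (Φ : ℕ ⥤ T) : ObjectProperty T := fun Z =>
  ∃ n : ℕ, ∀ (i : ℤ) (m m' : ℕ) (h : m + n ≤ m') (f : Z⟦i⟧ ⟶ Φ.obj m),
    f ≫ Φ.map (homOfLE (show m ≤ m' by lia)) = 0

instance (Φ : ℕ ⥤ T) : (eventuallyGhost Φ).IsStableUnderRetracts where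
  of_retract := by
    rintro X Y r ⟨n, hn⟩
    refine ⟨n, fun i m m' h f => ?_⟩
    let r' : Retract (X⟦i⟧) (Y⟦i⟧) := r.map (shiftFunctor T i)
    rw [← cancel_epi r'.r, comp_zero, ← Category.assoc, hn i m m' h]

instance (Φ : ℕ ⥤ T) : (eventuallyGhost Φ).IsTriangulated where
  exists_zero := ⟨0, isZero_zero _, 0, fun i _ _ _ _ =>
    ((shiftFunctor T i).map_isZero (isZero_zero T)).eq_of_src _ _⟩
  isStableUnderShiftBy a :=
    { le_shift := by
        rintro X ⟨n, hn⟩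
        refine ⟨n, fun i m m' h f => ?_⟩
        let e : X⟦a + i⟧ ≅ (X⟦a⟧)⟦i⟧ := (shiftFunctorAdd T a i).app X
        rw [← cancel_epi e.hom, comp_zero, ← Category.assoc, hn _ m m' h] }
  ext₂' := by
    rintro ⟨X, Y, Z, u, v, w⟩ hT ⟨n, hn⟩ ⟨k, hk⟩
    refine ObjectProperty.le_isoClosure _ _ ⟨n + k, fun i m m' h f => ?_⟩
    have hT' : Triangle.mk (i.negOnePow • u⟦i⟧') (i.negOnePow • v⟦i⟧')
        (i.negOnePow • w⟦i⟧' ≫ (shiftFunctorComm T 1 i).hom.app X) ∈ distTriang T :=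
      Triangle.shift_distinguished _ hT i
    -- After n steps the restriction to the shift of X is zero, so the map factors through the shift
    -- of Z, and k further steps kill it.
    obtain ⟨g, hg⟩ := exists_eq_comp_mor₂ hT' (f ≫ Φ.map (homOfLE (show m ≤ m + n by lia)))
      ((Category.assoc _ _ _).symm.trans (hn i m (m + n) le_rfl _))
    rw [← homOfLE_comp (show m ≤ m + n by lia) (show m + n ≤ m' by lia), Φ.map_comp,
      ← Category.assoc, hg, Category.assoc, hk i (m + n) m' (by lia), comp_zero]

lemma eventuallyGhost_of_triangEnvelope {Φ : ℕ ⥤ T} {G : T}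
    (hΦ : ∀ (n : ℕ) (i : ℤ) (f : G⟦i⟧ ⟶ Φ.obj n), f ≫ Φ.map (homOfLE n.le_succ) = 0) :
    (ObjectProperty.singleton G).triangEnvelope ≤ eventuallyGhost Φ := by
  rw [ObjectProperty.triangEnvelope_le_iff]
  rintro _ ⟨⟩
  refine ⟨1, fun i m m' h f => ?_⟩
  rw [← homOfLE_comp m.le_succ h, Φ.map_comp, ← Category.assoc, hΦ, zero_comp]

end

/-! ### Finiteness of Hom out of perfect complexes -/

namespace DerivedCategory

open Limits Pretriangulated

section

variable (R : Type u) [CommRing R] {Λ : Type u} [Ring Λ] [Algebra R Λ]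
  [HasDerivedCategory.{w} (ModuleCat.{u} Λ)]

variable (Λ) in
/-- The objects `G` such that the morphisms from `G` to bounded complexes with finitely generated
homology form finitely generated `R`-modules. -/
def finiteHom : ObjectProperty (DerivedCategory (ModuleCat.{u} Λ)) := fun G =>
  ∀ X, boundedFG Λ X → Module.Finite R (G ⟶ X)

variable [IsNoetherianRing R]

instance : (finiteHom R Λ).IsStableUnderRetracts where
  of_retract {X Y} r h Z hZ := by
    have := h Z hZ
    refine Module.Finite.of_injective (Linear.leftComp R Z r.r) fun f g hfg => ?_
    have := r.splitEpi.epi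
    exact (cancel_epi r.r).1 hfg

variable [IsNoetherianRing Λ]

instance : (finiteHom R Λ).IsTriangulated where
  exists_zero := ⟨0, isZero_zero _, fun X _ =>
    have : Subsingleton ((0 : DerivedCategory (ModuleCat.{u} Λ)) ⟶ X) :=
      ⟨fun f g => (isZero_zero _).eq_of_src f g⟩
    Module.Finite.of_finite⟩
  isStableUnderShiftBy n :=
    { le_shift := fun G hG X hX => by
        have := hG _ ((boundedFG Λ).le_shift (-n) X hX)
        let e : (G⟦n⟧)⟦-n⟧ ≅ G := (shiftFunctorCompIsoId _ n (-n) (by lia)).app G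
        refine Module.Finite.of_injective
          (Linear.leftComp R (X⟦-n⟧) e.inv ∘ₗ (shiftFunctor _ (-n)).mapLinearMap R) fun f g hfg => ?_
        exact (shiftFunctor _ (-n)).map_injective ((cancel_epi e.inv).1 hfg) }
  ext₂' := by
    rintro ⟨X, Y, Z, u, v, w⟩ hT hX hZ
    refine ObjectProperty.le_isoClosure _ _ fun W hW => ?_
    have : Module.Finite R (X ⟶ W) := hX W hW
    have : Module.Finite R (Z ⟶ W) := hZ W hW
    have : IsNoetherian R (Y ⟶ W) := isNoetherian_of_range_eq_ker
      (Linear.leftComp R W v) (Linear.leftComp R W u) (by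
        ext f
        rw [LinearMap.mem_ker, LinearMap.mem_range]
        constructor
        · rintro ⟨g, rfl⟩
          have h0 : u ≫ v = 0 := comp_distTriang_mor_zero₁₂ _ hT
          exact (Category.assoc _ _ _).symm.trans ((congr_arg (· ≫ g) h0).trans zero_comp)
        · intro hf
          obtain ⟨g, hg⟩ := exists_eq_comp_mor₂ hT f hf
          exact ⟨g, hg.symm⟩)
    exact inferInstanceAs (Module.Finite R (Y ⟶ W))

variable [Module.Finite R Λ]

attribute [local instance] baseModule baseModule_isScalarTower

variable (Λ) in
lemma finiteHom_regular : finiteHom R Λ (regular Λ) := by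
  intro X hX
  have : Projective (ModuleCat.of Λ Λ) := (IsProjective.iff_projective (ModuleCat.of Λ Λ)).1
    (inferInstanceAs (Module.Projective Λ Λ))
  have := hX.2 0
  have : Module.Finite R ((homologyFunctor (ModuleCat.{u} Λ) 0).obj X) :=
    Module.Finite.trans Λ _
  let e : (homologyFunctor (ModuleCat.{u} Λ) 0).obj (regular Λ) ≃ₗ[Λ] Λ :=
    (homologySingleIso 0 (ModuleCat.of Λ Λ)).toLinearEquiv
  -- Evaluation at the generator embeds the Hom module in H⁰ X, which is finite over R because Λ is.
  let ev : (regular Λ ⟶ X) →ₗ[R] ((homologyFunctor (ModuleCat.{u} Λ) 0).obj X) :=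
    { toFun := fun f => (homologyFunctor (ModuleCat.{u} Λ) 0).map f (e.symm 1)
      map_add' := fun f g => by rw [Functor.map_add]; rfl
      map_smul' := fun r f => by rw [Functor.map_smul]; rfl }
  refine Module.Finite.of_injective ev ((injective_iff_map_eq_zero ev).2 fun f hf => ?_)
  refine hom_from_single_eq_zero f ?_
  rw [← cancel_epi e.symm.toModuleIso.hom]
  ext
  exact hf

variable {R}

lemma finite_hom_of_kbProj {G X : DerivedCategory (ModuleCat.{u} Λ)} (hG : kbProj Λ G)
    (hX : boundedFG Λ X) : Module.Finite R (G ⟶ X) := by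
  rw [kbProj_eq_thickRegular] at hG
  refine ((ObjectProperty.triangEnvelope_le_iff _).2 ?_ : _ ≤ finiteHom R Λ) G hG X hX
  rintro _ ⟨⟩
  exact finiteHom_regular R Λ

end

end DerivedCategory

/-! ### Silting complexes are detected locally -/

noncomputable section

namespace DerivedCategory

open Limits Pretriangulated

lemma le_triangEnvelope_of_regular {A : Type u} [Ring A] [IsNoetherianRing A]
    [HasDerivedCategory.{w} (ModuleCat.{u} A)] {X : DerivedCategory (ModuleCat.{u} A)}
    (h : (ObjectProperty.singleton X).triangEnvelope (regular A)) :
    kbProj A ≤ (ObjectProperty.singleton X).triangEnvelope := by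
  rwa [kbProj_eq_thickRegular, ObjectProperty.triangEnvelope_le_iff,
    ObjectProperty.singleton_le_iff]

lemma kbProj_regular (A : Type u) [Ring A]
    [HasDerivedCategory.{w} (ModuleCat.{u} A)] : kbProj A (regular A) :=
  kbProj_single ⟨inferInstanceAs (Module.Finite A A), inferInstanceAs (Module.Projective A A)⟩ 0

lemma isSiltingComplex_iff {A : Type u} [Ring A] [IsNoetherianRing A]
    [HasDerivedCategory.{w} (ModuleCat.{u} A)] (X : DerivedCategory (ModuleCat.{u} A)) :
    IsSiltingComplex A X ↔ kbProj A X ∧ IsPresilting X ∧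
      (ObjectProperty.singleton X).triangEnvelope (regular A) := by
  constructor
  · rintro ⟨hX, h⟩
    obtain ⟨h1, h2⟩ := (isSilting_fullSubcategory_iff _ hX).1 h
    exact ⟨hX, h1, h2 _ (kbProj_regular A)⟩
  · rintro ⟨hX, h1, h2⟩
    exact ⟨hX, (isSilting_fullSubcategory_iff _ hX).2 ⟨h1, le_triangEnvelope_of_regular h2⟩⟩

section

variable {R : Type u} [CommRing R] {Λ : Type u} [Ring Λ] [Algebra R Λ] (S : Submonoid R)
  [HasDerivedCategory.{w} (ModuleCat.{u} Λ)] [IsNoetherianRing Λ]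
  [HasDerivedCategory.{w'} (ModuleCat.{u} (LocAlg Λ S))]

lemma isSiltingComplex_locDerived [IsNoetherianRing (LocAlg Λ S)]
    {X : DerivedCategory (ModuleCat.{u} Λ)} (hX : IsSiltingComplex Λ X) :
    IsSiltingComplex (LocAlg Λ S) ((locDerived Λ S).obj X) := by
  obtain ⟨hX, h1, h2⟩ := (isSiltingComplex_iff X).1 hX
  refine (isSiltingComplex_iff _).2 ⟨kbProj_locDerived S hX, fun i hi g => ?_, ?_⟩
  · obtain ⟨s, hs, f, hf⟩ := (homLocalized_of_kbProj S hX _).2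
      (g ≫ ((locDerived Λ S).commShiftIso i).inv.app X)
    rw [h1 i hi f, Functor.map_zero] at hf
    rw [← cancel_mono (((locDerived Λ S).commShiftIso i).inv.app X), zero_comp]
    exact smul_eq_zero_of_isUnit (isUnit_algebraMap_locAlg S hs) _ hf.symm
  · refine ObjectProperty.prop_of_iso _ (locDerivedRegularIso Λ S) ?_
    refine ((ObjectProperty.triangEnvelope_le_iff _).2 (ObjectProperty.singleton_le_iff.2 ?_) :
      _ ≤ (ObjectProperty.singleton _).triangEnvelope.inverseImage (locDerived Λ S)) _ h2
    exact ObjectProperty.triangEnvelope_singleton_self _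

/-- Ghosts stay ghosts under localisation: up to an element of S, now invertible, g comes from a map
out of G⟦i⟧, which t kills. -/
lemma locDerived_comp_eq_zero {G X Y : DerivedCategory (ModuleCat.{u} Λ)} (hG : kbProj Λ G)
    (t : X ⟶ Y) (ht : ∀ (i : ℤ) (f : G⟦i⟧ ⟶ X), f ≫ t = 0) (i : ℤ)
    (g : ((locDerived Λ S).obj G)⟦i⟧ ⟶ (locDerived Λ S).obj X) :
    g ≫ (locDerived Λ S).map t = 0 := by
  obtain ⟨s, hs, f, hf⟩ := (homLocalized_of_kbProj S ((kbProj Λ).le_shift i G hG) _).2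
    (((locDerived Λ S).commShiftIso i).hom.app G ≫ g)
  rw [← cancel_epi (((locDerived Λ S).commShiftIso i).hom.app G), comp_zero]
  refine smul_eq_zero_of_isUnit (isUnit_algebraMap_locAlg S hs) _ ?_
  rw [← Category.assoc, ← Linear.smul_comp, ← hf, ← Functor.map_comp, ht, Functor.map_zero]

end

section

variable {Λ : Type u} [Ring Λ] [IsNoetherianRing Λ] [HasDerivedCategory.{w} (ModuleCat.{u} Λ)]

lemma exists_finset_hom_shift_eq_zero {G X : DerivedCategory (ModuleCat.{u} Λ)}
    (hG : kbProj Λ G) (hX : boundedFG Λ X) :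
    ∃ I : Finset ℤ, ∀ i ∉ I, ∀ f : G⟦i⟧ ⟶ X, f = 0 := by
  obtain ⟨c, hc⟩ := exists_hom_eq_zero_of_kbProj hG
  obtain ⟨⟨_, b', _⟩, _⟩ := boundedFG_of_dbMod (dbMod_of_kbProj hG)
  obtain ⟨⟨⟨a, _⟩, b, _⟩, _⟩ := hX
  -- Below c - b, the object X⟦-i⟧ lies in D^{≤ c}; above b' - a, the object G⟦i⟧ lies in degrees
  -- below a.
  refine ⟨Finset.Icc (c - b) (b' - a), fun i hi f => ?_⟩
  rw [Finset.mem_Icc, not_and_or, not_le, not_le] at hi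
  rcases hi with hi | hi
  · have h : (X⟦-i⟧).IsLE c :=
      have := TStructure.t.isLE_shift X b (-i) (b + i)
      TStructure.t.isLE_of_le _ (b + i) c
    let e : (G⟦i⟧)⟦-i⟧ ≅ G := (shiftFunctorCompIsoId _ i (-i) (by lia)).app G
    refine (shiftFunctor _ (-i)).map_injective ?_
    rw [← cancel_epi e.inv, hc _ h (e.inv ≫ f⟦-i⟧'), Functor.map_zero, comp_zero]
  · have := TStructure.t.isLE_shift G b' i (b' - i)
    exact TStructure.t.zero f (b' - i) a

/-- Every bounded complex `X` with finitely generated homology has a morphism `X ⟶ Y` killing all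
morphisms from shifts of `G`, whose cone is built from `G`. -/
lemma exists_ghost (R : Type u) [CommRing R] [IsNoetherianRing R] [Algebra R Λ]
    [Module.Finite R Λ] {G X : DerivedCategory (ModuleCat.{u} Λ)} (hG : kbProj Λ G)
    (hX : boundedFG Λ X) : ∃ (Y : DerivedCategory (ModuleCat.{u} Λ)) (t : X ⟶ Y),
      boundedFG Λ Y ∧ (ObjectProperty.singleton G).triangEnvelope.trW t ∧
        ∀ (i : ℤ) (f : G⟦i⟧ ⟶ X), f ≫ t = 0 := by
  obtain ⟨I, hI⟩ := exists_finset_hom_shift_eq_zero hG hX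
  have hfin (i : I) : ∃ (k : ℕ) (φ : Fin k → (G⟦i.1⟧ ⟶ X)), Submodule.span R (Set.range φ) = ⊤ :=
    have := finite_hom_of_kbProj (R := R) ((kbProj Λ).le_shift i.1 G hG) hX
    Module.Finite.exists_fin
  choose k φ hφ using hfin
  let F (j : Σ i : I, Fin (k i)) : DerivedCategory (ModuleCat.{u} Λ) := G⟦j.1.1⟧
  -- Only finitely many shifts map nontrivially to X, each with finitely generated Hom over R, so a
  -- finite sum suffices and the cone stays bounded with finitely generated homology.
  let q : (⨁ F) ⟶ X := biproduct.desc fun j => φ j.1 j.2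
  have hGE := ObjectProperty.triangEnvelope_singleton_self G
  obtain ⟨Y, t, h, hT⟩ := distinguished_cocone_triangle q
  refine ⟨Y, t, ObjectProperty.ext_of_isTriangulatedClosed₃ _ _ hT
    (ObjectProperty.prop_biproduct _ _ fun j => (boundedFG Λ).le_shift _ _
      (boundedFG_of_dbMod (dbMod_of_kbProj hG))) hX,
    (ObjectProperty.trW_iff' _ _).2 ⟨_, q, h, hT, ObjectProperty.prop_biproduct _ _ fun j =>
      (ObjectProperty.singleton G).triangEnvelope.le_shift j.1.1 G hGE⟩, fun i f => ?_⟩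
  have h0 : q ≫ t = 0 := comp_distTriang_mor_zero₁₂ _ hT
  by_cases hi : i ∈ I
  · have : Submodule.span R (Set.range (φ ⟨i, hi⟩)) ≤ LinearMap.ker (Linear.rightComp R (G⟦i⟧) t) := by
      rw [Submodule.span_le]
      rintro _ ⟨j, rfl⟩
      have h1 : biproduct.ι F ⟨⟨i, hi⟩, j⟩ ≫ q = φ ⟨i, hi⟩ j := biproduct.ι_desc _ _
      exact (congr_arg (· ≫ t) h1.symm).trans ((Category.assoc _ _ _).trans (by rw [h0, comp_zero]))
    rw [hφ] at this
    exact this (Submodule.mem_top (x := f))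
  · rw [hI i hi f, zero_comp]

lemma exists_ghost_tower (R : Type u) [CommRing R] [IsNoetherianRing R] [Algebra R Λ]
    [Module.Finite R Λ] {G X : DerivedCategory (ModuleCat.{u} Λ)} (hG : kbProj Λ G)
    (hX : boundedFG Λ X) : ∃ (Φ : ℕ ⥤ DerivedCategory (ModuleCat.{u} Λ)) (f : X ⟶ Φ.obj 0),
      (∀ n, boundedFG Λ (Φ.obj n)) ∧
      (∀ n, (ObjectProperty.singleton G).triangEnvelope.trW (f ≫ Φ.map (homOfLE (Nat.zero_le n)))) ∧
      ∀ (n : ℕ) (i : ℤ) (g : G⟦i⟧ ⟶ Φ.obj n), g ≫ Φ.map (homOfLE (Nat.le_succ n)) = 0 := by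
  choose Y t hY hW ht using fun X : {X // boundedFG Λ X} => exists_ghost R hG X.2
  let Z (n : ℕ) : {X // boundedFG Λ X} := n.rec ⟨X, hX⟩ fun _ W => ⟨Y W, hY W⟩
  let τ (n : ℕ) : (Z n).1 ⟶ (Z (n + 1)).1 := t (Z n)
  refine ⟨Functor.ofSequence τ, 𝟙 X, fun n => (Z n).2, fun n => ?_, fun n i g => ?_⟩
  · change (ObjectProperty.singleton G).triangEnvelope.trW
      (𝟙 ((Functor.ofSequence τ).obj 0) ≫ (Functor.ofSequence τ).map (homOfLE (Nat.zero_le n)))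
    rw [Category.id_comp]
    induction n with
    | zero =>
      have := (Functor.ofSequence τ).map_id 0
      exact this ▸ MorphismProperty.id_mem _ _
    | succ n ih =>
      rw [← homOfLE_comp (Nat.zero_le n) n.le_succ, Functor.map_comp]
      refine MorphismProperty.comp_mem _ _ _ ih ?_
      rw [Functor.ofSequence_map_homOfLE_succ]
      exact hW (Z n)
  · rw [Functor.ofSequence_map_homOfLE_succ]
    exact ht (Z n) i g

variable {R : Type u} [CommRing R] [IsNoetherianRing R] [Algebra R Λ]
  [∀ p : PrimeSpectrum R,
    HasDerivedCategory.{w'} (ModuleCat.{u} (LocAlg Λ p.asIdeal.primeCompl))]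

/-- The number of ghost steps needed to kill Λ_𝔭 depends on 𝔭; noetherianity of R yields one n valid
globally. -/
lemma triangEnvelope_of_locAtPrime [Module.Finite R Λ] {X : DerivedCategory (ModuleCat.{u} Λ)} (hX : kbProj Λ X)
    (h : ∀ p : PrimeSpectrum R, (ObjectProperty.singleton (locAtPrime p X)).triangEnvelope
      (regular (LocAlg Λ p.asIdeal.primeCompl))) :
    (ObjectProperty.singleton X).triangEnvelope (regular Λ) := by
  obtain ⟨Φ, f, -, hW, hΦ⟩ := exists_ghost_tower R hX
    (boundedFG_of_dbMod (dbMod_of_kbProj (kbProj_regular Λ)))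
  obtain ⟨n, hn⟩ := exists_eq_zero_of_locally (R := R) _
    (fun n => f ≫ Φ.map (homOfLE (Nat.zero_le n)))
    (fun n => ⟨Φ.map (homOfLE (Nat.le_succ n)), by
      rw [Category.assoc, ← Φ.map_comp, homOfLE_comp]⟩)
    (fun p => by
      let F := locDerived Λ p.asIdeal.primeCompl
      obtain ⟨n, hn⟩ := ObjectProperty.prop_of_iso _ (locDerivedRegularIso Λ _).symm
        (eventuallyGhost_of_triangEnvelope (Φ := Φ ⋙ F)
          (fun n i g => locDerived_comp_eq_zero _ hX _ (hΦ n) i g) _ (h p))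
      refine ⟨n, (homLocalized_regular Λ _ _).1 _ ?_⟩
      let e := (shiftFunctorZero _ ℤ).app (F.obj (regular Λ))
      rw [← cancel_epi e.hom, comp_zero, F.map_comp, ← Category.assoc]
      exact hn 0 0 n (by lia) _)
  exact ObjectProperty.prop_of_trW_of_eq_zero _ (hW n) hn

lemma isPresilting_of_locAtPrime {X : DerivedCategory (ModuleCat.{u} Λ)} (hX : kbProj Λ X)
    (h : ∀ p : PrimeSpectrum R, IsPresilting (locAtPrime p X)) : IsPresilting X := by
  intro i hi f
  -- For a single morphism the sequence is taken constant.
  obtain ⟨_, hn⟩ := exists_eq_zero_of_locally (R := R) (fun _ => X⟦i⟧) (fun _ => f)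
    (fun _ => ⟨𝟙 _, Category.comp_id _⟩)
    (fun p => by
      let F := locDerived Λ p.asIdeal.primeCompl
      refine ⟨0, (homLocalized_of_kbProj _ hX _).1 f ?_⟩
      rw [← cancel_mono ((F.commShiftIso i).hom.app X), zero_comp]
      exact h p i hi _)
  exact hn

end

end DerivedCategory

end

lemma isNoetherianRing_locAlg {R : Type u} [CommRing R] [IsNoetherianRing R]
    (Λ : Type u) [Ring Λ] [Algebra R Λ] [Module.Finite R Λ] (S : Submonoid R) :
    IsNoetherianRing (LocAlg Λ S) :=
  have : IsNoetherianRing (Localization S) := IsLocalization.isNoetherianRing S _ inferInstance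
  isNoetherian_of_tower (Localization S)
    (inferInstance : IsNoetherian (Localization S) (LocAlg Λ S))

open DerivedCategory in
theorem mainTheorem11 {R : Type u} [CommRing R] [IsNoetherianRing R]
    {Λ : Type u} [Ring Λ] [Algebra R Λ] [Module.Finite R Λ]
    [HasDerivedCategory.{w} (ModuleCat.{u} Λ)]
    [∀ p : PrimeSpectrum R,
      HasDerivedCategory.{w'} (ModuleCat.{u} (LocAlg Λ p.asIdeal.primeCompl))]
    (P : DerivedCategory (ModuleCat.{u} Λ)) (hP : dbMod Λ P) :
    (kbProj Λ P ↔
      ∀ p : PrimeSpectrum R, kbProj (LocAlg Λ p.asIdeal.primeCompl) (locAtPrime p P)) ∧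
    (IsSiltingComplex Λ P ↔
      ∀ p : PrimeSpectrum R, IsSiltingComplex (LocAlg Λ p.asIdeal.primeCompl) (locAtPrime p P)) := by
  have : IsNoetherianRing Λ :=
    isNoetherian_of_tower R (inferInstance : IsNoetherian R Λ)
  have (p : PrimeSpectrum R) : IsNoetherianRing (LocAlg Λ p.asIdeal.primeCompl) :=
    isNoetherianRing_locAlg Λ _
  refine ⟨⟨fun h p => kbProj_locDerived _ h, kbProj_of_locAtPrime (boundedFG_of_dbMod hP)⟩,
    ⟨fun h p => isSiltingComplex_locDerived _ h, fun h => ?_⟩⟩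
  have h' (p : PrimeSpectrum R) := (isSiltingComplex_iff _).1 (h p)
  have hX : kbProj Λ P := kbProj_of_locAtPrime (boundedFG_of_dbMod hP) fun p => (h' p).1
  exact (isSiltingComplex_iff P).2 ⟨hX, isPresilting_of_locAtPrime hX fun p => (h' p).2.1,
    triangEnvelope_of_locAtPrime hX fun p => (h' p).2.2⟩
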